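/- Let $T=(V,E)$ be a finite tree with $p=|V|\ge 2$ vertices. Let $\mathbf C=[c_{i,j}]_{i,j\in V}$ be a real symmetric matrix with $c_i:=c_{i,i}>0$ for every $i\in V$, $c_{i,j}>0$ whenever $\{i,j\}\in E$, and $c_{i,j}=0$ for all other pairs. For $r\in V$ direct $T$ from the root $r$ outwards; write $\mathfrak C_r(i)$ for the set of children of $i$ and $\mathfrak p_r(i)$ for the parent of $i\ne r$. Define $\Phi_r(s)=(s_{i,(r)})_{i\in V}$ recursively, starting from the vertices farthest from $r$, by $$s_{i,(r)}=s_i\prod_{j\in\mathfrak C_r(i)}\Bigl(1+\frac{c_{i,j}}{c_i}\,s_{j,(r)}\Bigr)$$ (an empty product being $1$). For $\alpha,\gamma>0$ and $\beta\in\mathbb R$ let $\mathcal G(\alpha,\gamma)$ and $\mathcal K(\alpha,\beta,\gamma)$ be the probability laws on $(0,\infty)$ with densities proportional to $x^{\alpha-1}e^{-\gamma x}$ and $x^{\alpha-1}(1+x)^{-(\alpha+\beta)}e^{-\gamma x}$ respectively. For $\mathbf a\in(0,\infty)^V$ and a matrix $\mathbf C$ as above let $\mathrm{TK}(\mathbf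 a,\mathbf C)$ be the probability law on $(0,\infty)^V$ with density proportional to $$\prod_{i\in V}x_i^{a_i-1}\,\exp\Bigl(-\sum_{S\subseteq T}\ \prod_{i\in V(S)}\frac{x_i}{c_i^{\deg_S(i)-1}}\prod_{\{j,k\}\in E(S)}c_{j,k}\Bigr),$$ where the sum is over all (non-empty) subtrees $S$ of $T$. Let $\mathbf X=(X_i)_{i\in V}$ be a random vector whose law has a density that vanishes outside $(0,\infty)^V$ and is strictly positive and continuously differentiable on $(0,\infty)^V$. Suppose that for every leaf $r$ of $T$ (vertex of degree $1$) the components $X_{i,(r)}$, $i\in V$, of $\Phi_r(\mathbf X)$ are mutually independent. Then there exist $\mathbf a=(a_i)_{i\in V}\in(0,\infty)^V$ and $c>0$ such that for every $r\in V$ $$X_{r,(r)}\sim\mathcal G(a_r,\,c\,c_r),\qquad \frac{c_{\mathfrak p_r(i),i}}{c_{\mathfrak p_r(i)}}\,X_{i,(r)}\sim\mathcal K\Bigl(a_i,\;a_{\mathfrak p_r(i)}-a_i,\;c\,\frac{c_{\mathfrak p_r(i)}\,c_i}{c_{\mathfrak p_r(i),i}}\Bigr)\quad(i\in V\setminus\{r\}),$$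 and $\mathbf X\sim\mathrm{TK}(\mathbf a,c\,\mathbf C)$. -/

import Mathlib

open MeasureTheory ProbabilityTheory

noncomputable section

namespace TreeKummer

variable {V : Type*} [Fintype V]

/-- In the tree `T` directed away from the root `r`, the vertex `i` is the parent of `j`
(and `j` is a child of `i`): `{i, j}` is an edge and `j` is one step further from `r` than `i`. -/
def IsParent (T : SimpleGraph V) (r i j : V) : Prop :=
  T.Adj i j ∧ T.dist r j = T.dist r i + 1

/-- In a tree every vertex other than the root has exactly one parent. -/
theorem existsUnique_parent (T : SimpleGraph V) (hT : T.IsTree) (r i : V) (h : i ≠ r) :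
    ∃! j, IsParent T r j i := by
  obtain ⟨w, hw, hl⟩ := hT.connected.exists_path_of_dist i r
  cases w with
  | nil => exact absurd rfl h
  | @cons _ j _ hij w =>
    have e1 : T.dist r i = w.length + 1 := by rw [SimpleGraph.dist_comm, ← hl]; simp
    have := T.dist_le w
    have := hT.dist_eq_dist_add_one_of_adj r hij
    rw [SimpleGraph.dist_comm] at *
    refine ⟨j, ⟨hij.symm, ?_⟩, ?_⟩
    · have := T.dist_comm (u := j) (v := r); have := T.dist_comm (u := i) (v := r); omega
    · rintro k ⟨hk, hk2⟩
      obtain ⟨u, hu, hul⟩ := hT.connected.exists_path_of_dist k r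
      have hp : (SimpleGraph.Walk.cons hk.symm u).IsPath := by
        apply SimpleGraph.Walk.isPath_of_length_eq_dist
        rw [SimpleGraph.Walk.length_cons, hul, T.dist_comm, T.dist_comm (u := i), hk2]
      have := (hT.existsUnique_path i r).unique hp hw
      injection this

open Classical in
/-- The set of children of `i` in the tree `T` directed away from the root `r`. -/
def children (T : SimpleGraph V) (r i : V) : Finset V :=
  Finset.univ.filter (IsParent T r i)

/-- Matrices `C` with `C i i > 0`, `C i j = C j i > 0` on edges, and zero elsewhere. -/
structure IsParam (T : SimpleGraph V) (C : Matrix V V ℝ) : Prop where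
  symm : C.IsSymm
  diag_pos : ∀ i, 0 < C i i
  edge_pos : ∀ i j, T.Adj i j → 0 < C i j
  eq_zero : ∀ i j, i ≠ j → ¬ T.Adj i j → C i j = 0

/-- The `i`-th coordinate of the transformation with root `r`, defined recursively from the
vertices furthest from the root:
`s_{i,(r)} = s_i * ∏_{j child of i} (1 + (c_{i,j} / c_i) * s_{j,(r)})`. -/
def Phi (T : SimpleGraph V) (C : Matrix V V ℝ) (r : V) (s : V → ℝ) (i : V) : ℝ :=
  s i * ∏ j ∈ (children T r i).attach, (1 + C i j.1 / C i i * Phi T C r s j.1)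
termination_by Finset.univ.sup (T.dist r) - T.dist r i
decreasing_by
  have h : IsParent T r i j.1 := by simpa [children] using j.2
  have h1 : T.dist r j.1 ≤ Finset.univ.sup (T.dist r) := Finset.le_sup (Finset.mem_univ _)
  have h2 := h.2
  omega

theorem Phi_eq (T : SimpleGraph V) (C : Matrix V V ℝ) (r : V) (s : V → ℝ) (i : V) :
    Phi T C r s i = s i * ∏ j ∈ children T r i, (1 + C i j / C i i * Phi T C r s j) := by
  rw [Phi, Finset.prod_attach (children T r i) (fun j => 1 + C i j / C i i * Phi T C r s j)]

/-- The open orthant `(0, ∞)^V`. -/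
def orthant (V : Type*) : Set (V → ℝ) := {x | ∀ i, 0 < x i}

/-- A measure rescaled to total mass one. -/
def normalize {α : Type*} [MeasurableSpace α] (m : Measure α) : Measure α :=
  (m Set.univ)⁻¹ • m

/-- The Kummer distribution `K(α, β, γ)` (for `α, γ > 0`), with density proportional to
`x ^ (α - 1) * (1 + x) ^ (-(α + β)) * exp (-γ x)` on `(0, ∞)`. -/
def kummerMeasure (α β γ : ℝ) : Measure ℝ :=
  normalize ((volume.restrict (Set.Ioi 0)).withDensity fun x =>
    ENNReal.ofReal (x ^ (α - 1) / (1 + x) ^ (α + β) * Real.exp (-(γ * x))))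

open Classical in
/-- The vertex sets of the subtrees of `T`: a subtree is an induced subgraph that is a tree. -/
def subtrees (T : SimpleGraph V) : Finset (Finset V) :=
  Finset.univ.filter fun U => (T.induce (U : Set V)).IsTree

open Classical in
/-- The degree of `i` in the subgraph of `T` induced on `U`. -/
def degIn (T : SimpleGraph V) (U : Finset V) (i : V) : ℕ :=
  (U.filter (T.Adj i)).card

open Classical in
/-- The edges of the subgraph of `T` induced on `U`. -/
def edgesIn (T : SimpleGraph V) (U : Finset V) : Finset (Sym2 V) :=
  T.edgeFinset.filter fun e => ∀ v ∈ e, v ∈ U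

/-- The entry `c_{j,k}` of a symmetric matrix at the unordered pair `{j, k}`. -/
def edgeWeight (C : Matrix V V ℝ) (hC : C.IsSymm) : Sym2 V → ℝ :=
  Sym2.lift ⟨fun j k => C j k, fun j k => hC.apply k j⟩

/-- The sum over subtrees `S` of `T` of
`∏_{i ∈ V(S)} x_i / c_i ^ (deg_S(i) - 1) * ∏_{{j,k} ∈ E(S)} c_{j,k}`. -/
def energy (T : SimpleGraph V) (C : Matrix V V ℝ) (hC : C.IsSymm) (x : V → ℝ) : ℝ :=
  ∑ U ∈ subtrees T, (∏ i ∈ U, x i / C i i ^ ((degIn T U i : ℤ) - 1)) *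
    ∏ e ∈ edgesIn T U, edgeWeight C hC e

/-- The tree-Kummer distribution `TK(a, C)`, with density proportional to
`∏_i x_i ^ (a_i - 1) * exp (-energy x)` on `(0, ∞)^V`. -/
def treeKummerMeasure (T : SimpleGraph V) (a : V → ℝ) (C : Matrix V V ℝ) (hC : C.IsSymm) :
    Measure (V → ℝ) :=
  normalize ((volume.restrict (orthant V)).withDensity fun x =>
    ENNReal.ofReal ((∏ i, x i ^ (a i - 1)) * Real.exp (-energy T C hC x)))

end TreeKummer

end

/-!
Let `L` be the logarithm of the density of `X` plus `∑ i, log (x i)`; up to a sum of functions of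
single coordinates it is the logarithmic density of `Φ_r(X)` in the coordinates `y = Φ_r(x)`, since
the Jacobian determinant of the inverse map is `∏ i, x i / y i`. Independence of the components of
`Φ_r(X)` makes this density invariant under exchanging a coordinate of two points, so `L` is
additive in each `y q`.

For an edge `{p, q}` choose leaves on its two sides, so that `p` is the parent of `q` for one of
them and `q` the parent of `p` for the other. With all coordinates off the edge
fixed, comparing the two separations yields the Matsumoto–Yor type equation
`F (u * (1 + k * v)) + H v = G u + K (v * (1 + k' * u))`, which forces `s * F' s` and `s * K' s` to
be affine. As `F` describes the dependence of `L` on `x p`, this gives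
`x p * ∂L/∂(x p) = a p - c * (C p p * Φ_p(x) p)`, where `c` is the same for adjacent vertices, hence
for all vertices.

The subtree sum satisfies `energy x = ∑ i, C i i * Φ_r(x) i` for every root `r`, by removing leaves
one at a time. Taking `r = p`, only the term `i = p` depends on `x p`, and linearly, so `L` and
`∑ i, a i * log (x i) - c * energy x` have the same gradient. The same identity factorizes the
tree-Kummer density in the coordinates `Φ_r(x)`, which gives the laws of the components;
integrability of the gamma factor at the root makes `a` and `c` positive.
-/

noncomputable section

namespace TreeKummer

open Filter Topology Set

section FunctionalEquation

variable {α β g h a b : ℝ → ℝ} {A B : ℝ}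

theorem exists_tendsto_of_exchange (hα : ContinuousOn α (Ioi 0))
    (hg : ∀ x > 0, ∀ y > 0, (1 + x) * α (x * (1 + y)) = x * β (y * (1 + x)) + g x) :
    ∃ B, Tendsto β (𝓝[>] 0) (𝓝 B) := by
  have hα_one : Tendsto (fun t : ℝ => 2 * α (1 + t / 2) - g 1) (𝓝 0) (𝓝 (2 * α 1 - g 1)) := by
    have hα' : ContinuousAt α (1 + 0 / 2) := hα.continuousAt (Ioi_mem_nhds (by norm_num))
    have : ContinuousAt (fun t : ℝ => 2 * α (1 + t / 2) - g 1) 0 :=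
      ((hα'.comp (f := fun t : ℝ => 1 + t / 2) (by fun_prop)).const_mul 2).sub_const _
    simpa using this.tendsto
  refine ⟨2 * α 1 - g 1, (hα_one.mono_left nhdsWithin_le_nhds).congr' ?_⟩
  filter_upwards [self_mem_nhdsWithin] with t (ht : 0 < t)
  have := hg 1 one_pos (t / 2) (by positivity)
  rw [one_mul, show t / 2 * (1 + 1) = t by ring] at this
  linarith

theorem eq_of_exchange_of_tendsto (hα : ContinuousOn α (Ioi 0)) (hβ : Tendsto β (𝓝[>] 0) (𝓝 B))
    (hg : ∀ x > 0, ∀ y > 0, (1 + x) * α (x * (1 + y)) = x * β (y * (1 + x)) + g x)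
    {x : ℝ} (hx : 0 < x) : g x = (1 + x) * α x - x * B := by
  have hα_x : Tendsto (fun y => α (x * (1 + y))) (𝓝[>] 0) (𝓝 (α x)) := by
    have hα' : ContinuousAt α (x * (1 + 0)) := hα.continuousAt (Ioi_mem_nhds (by simpa))
    have : ContinuousAt (fun y => α (x * (1 + y))) 0 :=
      hα'.comp (f := fun y : ℝ => x * (1 + y)) (by fun_prop)
    simpa using this.tendsto.mono_left nhdsWithin_le_nhds
  have hβ_zero : Tendsto (fun y => β (y * (1 + x))) (𝓝[>] 0) (𝓝 B) := by
    refine hβ.comp (tendsto_nhdsWithin_iff.2 ⟨?_, ?_⟩)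
    · exact ((by fun_prop : Continuous fun y => y * (1 + x)).tendsto' 0 0 (zero_mul _)).mono_left
        nhdsWithin_le_nhds
    · filter_upwards [self_mem_nhdsWithin] with y (hy : 0 < y)
      exact mem_Ioi.2 (by positivity)
  refine tendsto_nhds_unique (tendsto_const_nhds.congr' ?_)
    ((hα_x.const_mul (1 + x)).sub (hβ_zero.const_mul x))
  filter_upwards [self_mem_nhdsWithin] with y hy
  linarith [hg x hx y hy]

theorem exchange_elimination
    (hg : ∀ x > 0, ∀ y > 0, (1 + x) * (a (x * (1 + y)) - a x) = x * b (y * (1 + x)))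
    (hh : ∀ x > 0, ∀ y > 0, (1 + y) * (b (y * (1 + x)) - b y) = y * a (x * (1 + y)))
    {x y : ℝ} (hx : 0 < x) (hy : 0 < y) :
    (1 + x + y) * a (x * (1 + y)) = (1 + x) * (1 + y) * a x + x * (1 + y) * b y := by
  linear_combination (1 + y) * hg x hx y hy + x * hh x hx y hy

theorem tendsto_div_of_exchange (ha : Tendsto a (𝓝[>] 0) (𝓝 0))
    (hab : ∀ x > 0, ∀ y > 0,
      (1 + x + y) * a (x * (1 + y)) = (1 + x) * (1 + y) * a x + x * (1 + y) * b y)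
    {s : ℝ} (hs : 0 < s) : Tendsto (fun y => b y / (1 + y)) atTop (𝓝 (a s / s)) := by
  have hx : Tendsto (fun y : ℝ => s / (1 + y)) atTop (𝓝 0) :=
    (tendsto_atTop_add_const_left _ 1 tendsto_id).const_div_atTop s
  have hax : Tendsto (fun y : ℝ => a (s / (1 + y))) atTop (𝓝 0) := by
    refine ha.comp (tendsto_nhdsWithin_iff.2 ⟨hx, ?_⟩)
    filter_upwards [eventually_gt_atTop 0] with y hy
    exact mem_Ioi.2 (by positivity)
  have hy : Tendsto (fun y : ℝ => (1 + y)⁻¹) atTop (𝓝 0) :=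
    tendsto_inv_atTop_zero.comp (tendsto_atTop_add_const_left _ 1 tendsto_id)
  have hlim : Tendsto (fun y : ℝ => (1 + s / (1 + y) * (1 + y)⁻¹) * (a s / s)
      - (1 + s / (1 + y)) * a (s / (1 + y)) / s) atTop (𝓝 (a s / s)) := by
    simpa using (((hx.mul hy).const_add 1).mul_const (a s / s)).sub
      (((hx.const_add 1).mul hax).div_const s)
  refine hlim.congr' ?_
  filter_upwards [eventually_gt_atTop 0] with y hy
  have key := hab (s / (1 + y)) (by positivity) y hy
  rw [div_mul_cancel₀ s (by positivity)] at key
  field_simp at key ⊢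
  linear_combination key

theorem eq_mul_of_exchange (ha : Tendsto a (𝓝[>] 0) (𝓝 0)) (hb : Tendsto b (𝓝[>] 0) (𝓝 0))
    (hg : ∀ x > 0, ∀ y > 0, (1 + x) * (a (x * (1 + y)) - a x) = x * b (y * (1 + x)))
    (hh : ∀ x > 0, ∀ y > 0, (1 + y) * (b (y * (1 + x)) - b y) = y * a (x * (1 + y))) :
    ∃ c, (∀ s > 0, a s = c * s) ∧ ∀ t > 0, b t = c * t := by
  have limit_b {s : ℝ} (hs : 0 < s) : Tendsto (fun y => b y / (1 + y)) atTop (𝓝 (a s / s)) :=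
    tendsto_div_of_exchange ha (fun _ hx _ hy => exchange_elimination hg hh hx hy) hs
  have limit_a {s : ℝ} (hs : 0 < s) : Tendsto (fun y => a y / (1 + y)) atTop (𝓝 (b s / s)) :=
    tendsto_div_of_exchange hb (fun _ hx _ hy => exchange_elimination
      (fun x hx y hy => hh y hy x hx) (fun x hx y hy => hg y hy x hx) hx hy) hs
  have ha_lin (s) (hs : 0 < s) : a s = a 1 * s := by
    rw [← div_eq_iff hs.ne', tendsto_nhds_unique (limit_b hs) (limit_b one_pos), div_one]
  have limit_a' : Tendsto (fun y => a y / (1 + y)) atTop (𝓝 (a 1)) := by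
    have : Tendsto (fun y : ℝ => a 1 * (1 - (1 + y)⁻¹)) atTop (𝓝 (a 1)) := by
      simpa using ((tendsto_inv_atTop_zero.comp
        (tendsto_atTop_add_const_left _ (1 : ℝ) tendsto_id)).const_sub 1).const_mul (a 1)
    refine this.congr' ?_
    filter_upwards [eventually_gt_atTop 0] with y hy
    rw [ha_lin y hy]
    field_simp
    ring
  exact ⟨a 1, ha_lin, fun t ht =>
    (div_eq_iff ht.ne').1 (tendsto_nhds_unique (limit_a ht) limit_a')⟩

theorem exists_affine_of_exchange (hα : ContinuousOn α (Ioi 0)) (hβ : ContinuousOn β (Ioi 0))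
    (hg : ∀ x > 0, ∀ y > 0, (1 + x) * α (x * (1 + y)) = x * β (y * (1 + x)) + g x)
    (hh : ∀ x > 0, ∀ y > 0, (1 + y) * β (y * (1 + x)) = y * α (x * (1 + y)) + h y) :
    ∃ A B c, (∀ s > 0, α s = A - c * s) ∧ ∀ t > 0, β t = B - c * t := by
  obtain ⟨B, hB⟩ := exists_tendsto_of_exchange hα hg
  obtain ⟨A, hA⟩ := exists_tendsto_of_exchange hβ fun x hx y hy => hh y hy x hx
  obtain ⟨c, hα_lin, hβ_lin⟩ := eq_mul_of_exchange (a := fun s => α s - A) (b := fun t => β t - B)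
    (by simpa using hA.sub_const A) (by simpa using hB.sub_const B)
    (fun x hx y hy => by
      linear_combination hg x hx y hy + eq_of_exchange_of_tendsto hα hB hg hx)
    (fun x hx y hy => by
      linear_combination hh x hx y hy +
        eq_of_exchange_of_tendsto hβ hA (fun x hx y hy => hh y hy x hx) hy)
  exact ⟨A, B, -c, fun s hs => by linarith [hα_lin s hs], fun t ht => by linarith [hβ_lin t ht]⟩

theorem euler_identity_of_separation {k k' : ℝ} (hk : 0 < k) (hk' : 0 < k') {F G H K : ℝ → ℝ}
    (hF : DifferentiableOn ℝ F (Ioi 0)) (hG : DifferentiableOn ℝ G (Ioi 0))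
    (hK : DifferentiableOn ℝ K (Ioi 0))
    (hsep : ∀ u > 0, ∀ v > 0, F (u * (1 + k * v)) + H v = G u + K (v * (1 + k' * u)))
    {u v : ℝ} (hu : 0 < u) (hv : 0 < v) :
    (1 + k' * u) * (u * (1 + k * v) * deriv F (u * (1 + k * v))) =
      k' * u * (v * (1 + k' * u) * deriv K (v * (1 + k' * u))) +
        (1 + k' * u) * (u * deriv G u) := by
  have hFu := ((hF.differentiableAt (Ioi_mem_nhds (show 0 < u * (1 + k * v) by positivity))
    ).hasDerivAt.comp u ((hasDerivAt_id u).mul_const (1 + k * v))).add_const (H v)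
  have hGu := (hG.differentiableAt (Ioi_mem_nhds hu)).hasDerivAt
  have hKu := (hK.differentiableAt (Ioi_mem_nhds (show 0 < v * (1 + k' * u) by positivity))
    ).hasDerivAt.comp u ((((hasDerivAt_id u).const_mul k').const_add 1).const_mul v)
  have huniq := hFu.unique ((hGu.add hKu).congr_of_eventuallyEq (by
    filter_upwards [Ioi_mem_nhds hu] with w hw
    exact hsep w hw v hv))
  linear_combination u * (1 + k' * u) * huniq

theorem exists_euler_derivative_of_separation {k k' : ℝ} (hk : 0 < k) (hk' : 0 < k')
    {F G H K : ℝ → ℝ} (hF : ContDiffOn ℝ 1 F (Ioi 0)) (hG : DifferentiableOn ℝ G (Ioi 0))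
    (hH : DifferentiableOn ℝ H (Ioi 0)) (hK : ContDiffOn ℝ 1 K (Ioi 0))
    (hsep : ∀ u > 0, ∀ v > 0, F (u * (1 + k * v)) + H v = G u + K (v * (1 + k' * u))) :
    ∃ A B c : ℝ, (∀ s > 0, s * deriv F s = A - c * k' * s) ∧
      (∀ t > 0, t * deriv K t = B - c * k * t) ∧
      ∀ v > 0, (1 + k * v) * (v * deriv H v) = (1 + k * v) * (B - c * k * v) - A * k * v := by
  have euler_u (u) (hu : 0 < u) (v) (hv : 0 < v) := euler_identity_of_separation hk hk'
    (hF.differentiableOn one_ne_zero) hG (hK.differentiableOn one_ne_zero) hsep hu hv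
  have euler_v (u) (hu : 0 < u) (v) (hv : 0 < v) := euler_identity_of_separation (H := G) hk' hk
    (hK.differentiableOn one_ne_zero) hH (hF.differentiableOn one_ne_zero)
    (fun v hv u hu => by rw [add_comm, ← hsep u hu v hv, add_comm]) hv hu
  have continuousOn_euler {E : ℝ → ℝ} (hE : ContDiffOn ℝ 1 E (Ioi 0)) {d : ℝ} (hd : 0 < d) :
      ContinuousOn (fun z => z / d * deriv E (z / d)) (Ioi 0) :=
    ContinuousOn.mul (by fun_prop) ((hE.continuousOn_deriv_of_isOpen isOpen_Ioi le_rfl).comp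
      (f := fun z => z / d) (by fun_prop) fun z (hz : 0 < z) => div_pos hz hd)
  obtain ⟨A, B, c, hα, hβ⟩ := exists_affine_of_exchange
    (g := fun x => (1 + x) * (x / k' * deriv G (x / k')))
    (h := fun y => (1 + y) * (y / k * deriv H (y / k)))
    (continuousOn_euler hF hk') (continuousOn_euler hK hk)
    (fun x hx y hy => by
      convert euler_u (x / k') (by positivity) (y / k) (by positivity) using 4 <;> field_simp)
    (fun x hx y hy => by
      convert euler_v (x / k') (by positivity) (y / k) (by positivity) using 4 <;> field_simp)
  have hF' (s) (hs : 0 < s) : s * deriv F s = A - c * k' * s := by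
    simpa [hk'.ne', mul_assoc] using hα (k' * s) (by positivity)
  have hK' (t) (ht : 0 < t) : t * deriv K t = B - c * k * t := by
    simpa [hk.ne', mul_assoc] using hβ (k * t) (by positivity)
  refine ⟨A, B, c, hF', hK', fun v hv => ?_⟩
  have key := euler_v 1 one_pos v hv
  rw [hF' _ (by positivity), hK' _ (by positivity)] at key
  linear_combination -key

theorem euler_coefficients_unique {k A B c A' B' c' : ℝ} (hk : 0 < k)
    (h : ∀ v > 0, (1 + k * v) * (B - c * k * v) - A * k * v =
      (1 + k * v) * (B' - c' * k * v) - A' * k * v) : A = A' ∧ B = B' ∧ c = c' := by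
  have eval (y : ℝ) (hy : 0 < y) :
      (1 + y) * (B - c * y) - A * y = (1 + y) * (B' - c' * y) - A' * y := by
    simpa [mul_assoc, mul_div_cancel₀ y hk.ne'] using h (y / k) (by positivity)
  have h₁ := eval 1 (by norm_num)
  have h₂ := eval 2 (by norm_num)
  have h₃ := eval 3 (by norm_num)
  refine ⟨?_, ?_, ?_⟩ <;> linarith

end FunctionalEquation

section Orthant

variable {V : Type*}

theorem one_mem_orthant : (1 : V → ℝ) ∈ orthant V := fun _ => one_pos

theorem update_mem_orthant [DecidableEq V] {x : V → ℝ} (hx : x ∈ orthant V) (i : V) {t : ℝ}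
    (ht : 0 < t) : Function.update x i t ∈ orthant V := by
  intro j
  rw [Function.update_apply]
  split_ifs
  exacts [ht, hx j]

theorem orthant_eq_pi : orthant V = univ.pi fun _ => Ioi 0 := by
  ext x
  simp [orthant]

theorem isOpen_orthant [Finite V] : IsOpen (orthant V) := by
  rw [orthant_eq_pi]
  exact isOpen_set_pi finite_univ fun _ _ => isOpen_Ioi

theorem measurableSet_orthant [Countable V] : MeasurableSet (orthant V) := by
  rw [orthant_eq_pi]
  exact MeasurableSet.univ_pi fun _ => measurableSet_Ioi

theorem restrict_orthant_eq_pi [Fintype V] :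
    (volume : Measure (V → ℝ)).restrict (orthant V) =
      Measure.pi fun _ => volume.restrict (Ioi 0) := by
  rw [orthant_eq_pi, volume_pi, Measure.restrict_pi_pi]

end Orthant

section Parents

variable {V : Type*} {T : SimpleGraph V} {r r' i j l p q : V}

theorem isParent_self (h : T.Adj i j) : IsParent T i i j :=
  ⟨h, by rw [SimpleGraph.dist_self, SimpleGraph.dist_eq_one_iff_adj.2 h]⟩

theorem IsParent.ne_root (h : IsParent T r j i) : i ≠ r := by
  rintro rfl
  simpa using h.2

theorem IsParent.eq_left [Finite V] (hT : T.IsTree) (h : IsParent T r j i)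
    (h' : IsParent T r l i) : j = l := by
  cases nonempty_fintype V
  exact (existsUnique_parent T hT r i h.ne_root).unique h h'

theorem isParent_or_isParent (hT : T.IsTree) (r : V) (h : T.Adj i j) :
    IsParent T r i j ∨ IsParent T r j i :=
  (hT.dist_eq_dist_add_one_of_adj r h).symm.imp (fun hdist => ⟨h, hdist⟩)
    fun hdist => ⟨h.symm, hdist⟩

theorem IsParam.ratio_pos {C : Matrix V V ℝ} (hC : IsParam T C) (h : T.Adj i j) :
    0 < C i j / C i i :=
  div_pos (hC.edge_pos i j h) (hC.diag_pos i)

variable [Fintype V]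

theorem mem_children : j ∈ children T r i ↔ IsParent T r i j := by
  simp [children]

theorem mem_children_root : j ∈ children T r r ↔ T.Adj r j :=
  mem_children.trans ⟨And.left, isParent_self⟩

theorem mem_children_of_isParent (hT : T.IsTree) (h : IsParent T r j i) :
    l ∈ children T r i ↔ T.Adj i l ∧ l ≠ j := by
  rw [mem_children]
  refine ⟨fun hl => ⟨hl.1, ?_⟩, fun ⟨hil, hlj⟩ => ?_⟩
  · rintro rfl
    have := hl.2
    have := h.2
    omega
  · exact (isParent_or_isParent hT r hil).resolve_right fun hl => hlj (hl.eq_left hT h)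

theorem children_congr_root (hT : T.IsTree) (h : IsParent T r j i) (h' : IsParent T r' j i) :
    children T r i = children T r' i := by
  ext l
  rw [mem_children_of_isParent hT h, mem_children_of_isParent hT h']

@[elab_as_elim]
theorem children_induction (T : SimpleGraph V) (r : V) {motive : V → Prop}
    (step : ∀ i, (∀ j ∈ children T r i, motive j) → motive i) (i : V) : motive i := by
  induction hn : Finset.univ.sup (T.dist r) - T.dist r i using Nat.strong_induction_on
    generalizing i with
  | _ n ih =>
    refine step i fun j hj => ih _ ?_ j rfl
    have hle : T.dist r j ≤ Finset.univ.sup (T.dist r) := Finset.le_sup (Finset.mem_univ _)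
    have := (mem_children.1 hj).2
    omega

theorem exists_leaf_isParent [DecidableRel T.Adj] (hT : T.IsTree) (h : T.Adj p q) :
    ∃ r, T.degree r = 1 ∧ IsParent T r p q := by
  classical
  obtain ⟨r, hr, hmax⟩ := Finset.exists_max_image
    (Finset.univ.filter fun r => IsParent T r p q) (T.dist q) ⟨p, by simpa using isParent_self h⟩
  simp only [Finset.mem_filter, Finset.mem_univ, true_and] at hr hmax
  obtain ⟨m, hm, -⟩ := existsUnique_parent T hT q r hr.ne_root.symm
  refine ⟨r, SimpleGraph.degree_eq_one_iff_existsUnique_adj.2 ⟨m, hm.1.symm, fun s hs => ?_⟩, hr⟩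
  refine ((isParent_or_isParent hT q hs).resolve_left fun hs' => ?_).eq_left hT hm
  have hdist := hs'.2
  have := hr.2
  have := hT.connected.dist_triangle (u := s) (v := p) (w := q)
  have := hT.connected.dist_triangle (u := s) (v := r) (w := p)
  have := SimpleGraph.dist_eq_one_iff_adj.2 h
  have := SimpleGraph.dist_eq_one_iff_adj.2 hs.symm
  rw [T.dist_comm, T.dist_comm (u := q)] at hdist
  have := hmax s ⟨h, by omega⟩
  rw [T.dist_comm, T.dist_comm (u := q)] at this
  omega

end Parents

section Transform

variable {V : Type*} [Fintype V] {T : SimpleGraph V} {C : Matrix V V ℝ} {r r' i j p q : V}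
  {s s' y : V → ℝ}

theorem Phi_congr_root (hT : T.IsTree) (s : V → ℝ) (h : IsParent T r j i)
    (h' : IsParent T r' j i) : Phi T C r s i = Phi T C r' s i := by
  induction i using children_induction T r generalizing j with
  | _ i ih =>
    rw [Phi_eq, Phi_eq T C r', ← children_congr_root hT h h']
    congr 1
    refine Finset.prod_congr rfl fun l hl => ?_
    rw [ih l hl (mem_children.1 hl) (mem_children.1 (children_congr_root hT h h' ▸ hl))]

theorem Phi_eq_of_isParent (hT : T.IsTree) (h : IsParent T r j i) (s : V → ℝ) :
    Phi T C r s i = Phi T C j s i :=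
  Phi_congr_root hT s h (isParent_self h.1)

theorem Phi_congr (h : ∀ l, T.dist r i ≤ T.dist r l → s l = s' l) :
    Phi T C r s i = Phi T C r s' i := by
  induction i using children_induction T r with
  | _ i ih =>
    rw [Phi_eq, Phi_eq T C r s', h i le_rfl]
    congr 1
    refine Finset.prod_congr rfl fun j hj => ?_
    rw [ih j hj fun l hl => h l ?_]
    have := (mem_children.1 hj).2
    omega

theorem Phi_eq_mul_div (hs : s i ≠ 0) (h : ∀ l, T.dist r i < T.dist r l → s' l = s l) :
    Phi T C r s' i = s' i * (Phi T C r s i / s i) := by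
  rw [Phi_eq, Phi_eq T C r s, mul_div_cancel_left₀ _ hs]
  congr 1
  refine Finset.prod_congr rfl fun j hj => ?_
  rw [Phi_congr fun l hl => h l ?_]
  have := (mem_children.1 hj).2
  omega

theorem Phi_root_eq_mul (hT : T.IsTree) (h : T.Adj p q) (s : V → ℝ) :
    Phi T C p s p = Phi T C q s p * (1 + C p q / C p p * Phi T C p s q) := by
  classical
  have hq : q ∉ children T q p := fun hq =>
    ((mem_children_of_isParent hT (isParent_self h.symm)).1 hq).2 rfl
  have hchildren : children T p p = insert q (children T q p) := by
    ext j
    rw [mem_children_root, Finset.mem_insert, mem_children_of_isParent hT (isParent_self h.symm)]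
    rcases eq_or_ne j q with rfl | hj
    · simp [h]
    · simp [hj]
  rw [Phi_eq, Phi_eq T C q s p, hchildren, Finset.prod_insert hq,
    Finset.prod_congr rfl fun j hj => by
      rw [← Phi_eq_of_isParent (C := C) hT (mem_children.1 hj)]]
  ring

theorem continuous_Phi (r : V) : Continuous (Phi T C r) := by
  refine continuous_pi fun i => ?_
  induction i using children_induction T r with
  | _ i ih =>
    simp only [Phi_eq T C r _ i]
    exact (continuous_apply i).mul (continuous_finsetProd _ fun j hj =>
      continuous_const.add (continuous_const.mul (ih j hj)))

/-- The inverse of `Phi T C r` on the open orthant; unlike `Phi` it is given by a closed formula. -/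
def Psi (T : SimpleGraph V) (C : Matrix V V ℝ) (r : V) (y : V → ℝ) (i : V) : ℝ :=
  y i / ∏ j ∈ children T r i, (1 + C i j / C i i * y j)

theorem prod_children_pos (hC : IsParam T C) (hy : ∀ j ∈ children T r i, 0 < y j) :
    0 < ∏ j ∈ children T r i, (1 + C i j / C i i * y j) :=
  Finset.prod_pos fun j hj =>
    add_pos one_pos (mul_pos (hC.ratio_pos (mem_children.1 hj).1) (hy j hj))

theorem Phi_mem_orthant (hC : IsParam T C) (r : V) (hs : s ∈ orthant V) :
    Phi T C r s ∈ orthant V := by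
  intro i
  induction i using children_induction T r with
  | _ i ih =>
    rw [Phi_eq]
    exact mul_pos (hs i) (prod_children_pos hC ih)

theorem Psi_mem_orthant (hC : IsParam T C) (r : V) (hy : y ∈ orthant V) : Psi T C r y ∈ orthant V :=
  fun i => div_pos (hy i) (prod_children_pos hC fun j _ => hy j)

theorem Psi_Phi (hC : IsParam T C) (r : V) (hs : s ∈ orthant V) : Psi T C r (Phi T C r s) = s := by
  ext i
  rw [Psi, Phi_eq T C r s i]
  exact mul_div_cancel_right₀ _ (prod_children_pos hC fun j _ => Phi_mem_orthant hC r hs j).ne'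

theorem Phi_Psi (hC : IsParam T C) (r : V) (hy : y ∈ orthant V) : Phi T C r (Psi T C r y) = y := by
  ext i
  induction i using children_induction T r with
  | _ i ih =>
    rw [Phi_eq, Finset.prod_congr rfl fun j hj => by rw [ih j hj], Psi]
    exact div_mul_cancel₀ _ (prod_children_pos hC fun j _ => hy j).ne'

theorem image_Psi_orthant (hC : IsParam T C) (r : V) : Psi T C r '' orthant V = orthant V := by
  ext x
  constructor
  · rintro ⟨y, hy, rfl⟩
    exact Psi_mem_orthant hC r hy
  · exact fun hx => ⟨Phi T C r x, Phi_mem_orthant hC r hx, Psi_Phi hC r hx⟩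

end Transform

section Subtrees

variable {V : Type*} {T : SimpleGraph V} {l p : V} {U W : Finset V}

theorem connected_induce_singleton (l : V) : (T.induce ({l} : Set V)).Connected :=
  (SimpleGraph.connected_iff _).2 ⟨SimpleGraph.Preconnected.of_subsingleton, ⟨l, rfl⟩⟩

theorem connected_induce_insert (hU : (T.induce (U : Set V)).Connected) (hp : p ∈ U)
    (hpl : T.Adj p l) : (T.induce (insert l (U : Set V))).Connected := by
  rw [insert_eq, union_comm]
  exact SimpleGraph.connected_induce_union hU.preconnected
    (connected_induce_singleton l).preconnected hp rfl hpl

theorem connected_induce_of_insert (h : (T.induce (insert l (U : Set V))).Connected) (hl : l ∉ U)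
    (hp : p ∈ U) (huniq : ∀ j ∈ U, T.Adj j l → j = p) : (T.induce (U : Set V)).Connected := by
  have mem_of_ne {v : V} (hv : v ∈ insert l (U : Set V)) (hvl : v ≠ l) : v ∈ U :=
    hv.resolve_left hvl
  have hpre := h.preconnected.induce_of_degree_eq_one (s := {x | (x : V) ≠ l}) (by
    rintro ⟨v, hv⟩ hvl ⟨a, ha⟩ hva ⟨b, hb⟩ hvb
    obtain rfl : v = l := not_not.1 hvl
    have hva : T.Adj v a := hva
    have hvb : T.Adj v b := hvb
    exact Subtype.ext ((huniq a (mem_of_ne ha hva.ne') hva.symm).trans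
      (huniq b (mem_of_ne hb hvb.ne') hvb.symm).symm))
  let f : (T.induce (insert l (U : Set V))).induce {x : ↥(insert l (U : Set V)) | (x : V) ≠ l} →g
      T.induce (U : Set V) :=
    { toFun := fun x => ⟨x.1.1, mem_of_ne x.1.2 x.2⟩
      map_rel' := id }
  refine (SimpleGraph.connected_iff _).2 ⟨hpre.map f ?_, ⟨p, hp⟩⟩
  rintro ⟨v, hv⟩
  exact ⟨⟨⟨v, Or.inr hv⟩, ne_of_mem_of_not_mem hv hl⟩, rfl⟩

variable [Fintype V]

theorem mem_subtrees (hT : T.IsTree) : U ∈ subtrees T ↔ (T.induce (U : Set V)).Connected := by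
  simp only [subtrees, Finset.mem_filter, Finset.mem_univ, true_and]
  exact ⟨fun h => h.connected, fun h => ⟨h, hT.isAcyclic.induce _⟩⟩

theorem singleton_mem_subtrees (hT : T.IsTree) (l : V) : {l} ∈ subtrees T := by
  rw [mem_subtrees hT, Finset.coe_singleton]
  exact connected_induce_singleton l

theorem insert_mem_subtrees_iff [DecidableEq V] (hT : T.IsTree) (hl : l ∉ U) (hp : p ∈ U)
    (hpl : T.Adj p l) (huniq : ∀ j ∈ U, T.Adj j l → j = p) :
    insert l U ∈ subtrees T ↔ U ∈ subtrees T := by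
  rw [mem_subtrees hT, mem_subtrees hT, Finset.coe_insert]
  exact ⟨fun h => connected_induce_of_insert h hl hp huniq,
    fun h => connected_induce_insert h hp hpl⟩

theorem exists_adj_of_mem_subtrees (hT : T.IsTree) (hU : U ∈ subtrees T) (hl : l ∈ U)
    (hne : U ≠ {l}) : ∃ j ∈ U, T.Adj l j := by
  have : Nontrivial (U : Set V) :=
    (Finset.nontrivial_coe.2 ((Finset.nontrivial_iff_ne_singleton hl).2 hne)).coe_sort
  obtain ⟨⟨j, hj⟩, hlj⟩ :=
    ((mem_subtrees hT).1 hU).preconnected.exists_adj_of_nontrivial ⟨l, hl⟩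
  exact ⟨j, hj, hlj⟩

variable [DecidableEq V] [DecidableRel T.Adj]

theorem filter_subtrees_subset_insert (hT : T.IsTree) (hl : l ∉ W)
    (huniq : ∀ j ∈ W, T.Adj j l → ∀ k ∈ W, T.Adj k l → j = k) :
    ((subtrees T).filter (· ⊆ insert l W)) =
      insert {l} ((subtrees T).filter (· ⊆ W) ∪
        ((subtrees T).filter fun U => U ⊆ W ∧ ∃ j ∈ U, T.Adj j l).image (insert l)) := by
  ext U
  simp only [Finset.mem_filter, Finset.mem_insert, Finset.mem_union, Finset.mem_image]
  constructor
  · rintro ⟨hU, hUW⟩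
    by_cases hlU : l ∈ U
    · refine or_iff_not_imp_left.2 fun hne => Or.inr ?_
      obtain ⟨p, hpU, hlp⟩ := exists_adj_of_mem_subtrees hT hU hlU hne
      have hp : p ∈ U.erase l := Finset.mem_erase.2 ⟨hlp.ne', hpU⟩
      have hsub : U.erase l ⊆ W := Finset.subset_insert_iff.1 hUW
      refine ⟨U.erase l, ⟨?_, hsub, p, hp, hlp.symm⟩, Finset.insert_erase hlU⟩
      rwa [← insert_mem_subtrees_iff hT (Finset.notMem_erase l U) hp hlp.symm
        fun j hj hjl => huniq j (hsub hj) hjl p (hsub hp) hlp.symm, Finset.insert_erase hlU]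
    · exact Or.inr (Or.inl ⟨hU, (Finset.subset_insert_iff_of_notMem hlU).1 hUW⟩)
  · rintro (rfl | ⟨hU, hUW⟩ | ⟨U, ⟨hU, hUW, p, hp, hpl⟩, rfl⟩)
    · exact ⟨singleton_mem_subtrees hT l, by simp⟩
    · exact ⟨hU, hUW.trans (Finset.subset_insert l W)⟩
    · refine ⟨?_, Finset.insert_subset_insert l hUW⟩
      rwa [insert_mem_subtrees_iff hT (fun h => hl (hUW h)) hp hpl
        fun j hj hjl => huniq j (hUW hj) hjl p (hUW hp) hpl]

theorem sum_subtrees_subset_insert (hT : T.IsTree) (hl : l ∉ W)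
    (huniq : ∀ j ∈ W, T.Adj j l → ∀ k ∈ W, T.Adj k l → j = k) (w : Finset V → ℝ) :
    ∑ U ∈ subtrees T with U ⊆ insert l W, w U = w {l} +
      ∑ U ∈ subtrees T with U ⊆ W, (w U + if ∃ j ∈ U, T.Adj j l then w (insert l U) else 0) := by
  rw [filter_subtrees_subset_insert hT hl huniq, Finset.sum_insert, Finset.sum_union,
    Finset.sum_image, Finset.sum_add_distrib, ← Finset.sum_filter, Finset.filter_filter]
  · intro U hU U' hU' h
    simp only [Finset.coe_filter, mem_ofPred_eq] at hU hU'
    rw [← Finset.erase_insert (fun hlU => hl (hU.2.1 hlU)), h,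
      Finset.erase_insert (fun hlU => hl (hU'.2.1 hlU))]
  · rw [Finset.disjoint_left]
    rintro _ hU hU'
    obtain ⟨U, -, rfl⟩ := Finset.mem_image.1 hU'
    exact hl ((Finset.mem_filter.1 hU).2 (Finset.mem_insert_self l U))
  · simp only [Finset.mem_union, Finset.mem_filter, Finset.mem_image, not_or, not_and, not_exists]
    refine ⟨fun _ h => hl (h (Finset.mem_singleton_self l)), ?_⟩
    rintro U ⟨-, hUW, j, hj, -⟩ h
    have hjl : j = l := Finset.mem_singleton.1 (h ▸ Finset.mem_insert_of_mem hj)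
    exact hl (hUW (hjl ▸ hj))

end Subtrees

section InducedSubgraph

variable {V : Type*} {T : SimpleGraph V} {l p : V} {U : Finset V}

theorem degIn_singleton (T : SimpleGraph V) (l : V) : degIn T {l} l = 0 := by
  classical
  simp [degIn, Finset.filter_singleton]

theorem degIn_insert_self [DecidableEq V] (hp : p ∈ U) (hpl : T.Adj p l)
    (huniq : ∀ j ∈ U, T.Adj j l → j = p) : degIn T (insert l U) l = 1 := by
  classical
  refine Finset.card_eq_one.2 ⟨p, ?_⟩
  ext j
  simp only [Finset.mem_filter, Finset.mem_insert, Finset.mem_singleton]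
  constructor
  · rintro ⟨rfl | hj, hlj⟩
    exacts [absurd rfl hlj.ne, huniq j hj hlj.symm]
  · rintro rfl
    exact ⟨Or.inr hp, hpl.symm⟩

theorem degIn_insert_of_adj [DecidableEq V] (hl : l ∉ U) (hpl : T.Adj p l) :
    degIn T (insert l U) p = degIn T U p + 1 := by
  classical
  rw [degIn, degIn, Finset.filter_insert, if_pos hpl, Finset.card_insert_of_notMem]
  simp [hl]

theorem degIn_insert_of_not_adj [DecidableEq V] (hpl : ¬T.Adj p l) :
    degIn T (insert l U) p = degIn T U p := by
  classical
  rw [degIn, degIn, Finset.filter_insert, if_neg hpl]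

variable [Fintype V]

theorem edgesIn_singleton (T : SimpleGraph V) (l : V) : edgesIn T {l} = ∅ := by
  classical
  rw [edgesIn, Finset.filter_eq_empty_iff]
  rintro ⟨a, b⟩ hab h
  rw [SimpleGraph.mem_edgeFinset] at hab
  have ha : a = l := Finset.mem_singleton.1 (h a (Sym2.mem_mk_left a b))
  have hb : b = l := Finset.mem_singleton.1 (h b (Sym2.mem_mk_right a b))
  exact SimpleGraph.Adj.ne hab (ha.trans hb.symm)

theorem edgesIn_insert [DecidableEq V] (hp : p ∈ U) (hpl : T.Adj p l)
    (huniq : ∀ j ∈ U, T.Adj j l → j = p) :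
    edgesIn T (insert l U) = insert s(p, l) (edgesIn T U) := by
  ext e
  induction e with
  | _ a b =>
    simp only [edgesIn, Finset.mem_filter, Finset.mem_insert, SimpleGraph.mem_edgeFinset,
      SimpleGraph.mem_edgeSet, Sym2.mem_iff, forall_eq_or_imp, forall_eq, Sym2.eq_iff]
    constructor
    · rintro ⟨hab, rfl | ha, rfl | hb⟩
      · exact absurd rfl hab.ne
      · exact Or.inl (Or.inr ⟨rfl, huniq b hb hab.symm⟩)
      · exact Or.inl (Or.inl ⟨huniq a ha hab, rfl⟩)
      · exact Or.inr ⟨hab, ha, hb⟩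
    · rintro ((⟨rfl, rfl⟩ | ⟨rfl, rfl⟩) | ⟨hab, ha, hb⟩)
      · exact ⟨hpl, Or.inr hp, Or.inl rfl⟩
      · exact ⟨hpl.symm, Or.inl rfl, Or.inr hp⟩
      · exact ⟨hab, Or.inr ha, Or.inr hb⟩

end InducedSubgraph

section Energy

variable {V : Type*} [Fintype V] {T : SimpleGraph V} {C : Matrix V V ℝ} {l p r : V}
  {U W : Finset V} {s x : V → ℝ}

/-- The summand of `energy` attached to the subtree with vertex set `U`. -/
def subtreeWeight (T : SimpleGraph V) (C : Matrix V V ℝ) (hC : C.IsSymm) (x : V → ℝ)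
    (U : Finset V) : ℝ :=
  (∏ i ∈ U, x i / C i i ^ ((degIn T U i : ℤ) - 1)) * ∏ e ∈ edgesIn T U, edgeWeight C hC e

theorem subtreeWeight_mul (hC : C.IsSymm) (x t : V → ℝ) (U : Finset V) :
    subtreeWeight T C hC (fun i => x i * t i) U = subtreeWeight T C hC x U * ∏ i ∈ U, t i := by
  simp only [subtreeWeight, mul_div_right_comm, Finset.prod_mul_distrib]
  ring

theorem subtreeWeight_singleton (hC : C.IsSymm) (x : V → ℝ) (l : V) :
    subtreeWeight T C hC x {l} = C l l * x l := by
  simp [subtreeWeight, degIn_singleton, edgesIn_singleton, mul_comm]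

theorem subtreeWeight_insert [DecidableEq V] (hC : IsParam T C) (x : V → ℝ) (hl : l ∉ U)
    (hp : p ∈ U) (hpl : T.Adj p l) (huniq : ∀ j ∈ U, T.Adj j l → j = p) :
    subtreeWeight T C hC.symm x (insert l U) =
      subtreeWeight T C hC.symm x U * (C p l / C p p * x l) := by
  have hCp := (hC.diag_pos p).ne'
  have hedge : s(p, l) ∉ edgesIn T U := by simp [edgesIn, hl]
  have hpow : C p p ^ ((degIn T (insert l U) p : ℤ) - 1) =
      C p p ^ ((degIn T U p : ℤ) - 1) * C p p := by
    rw [degIn_insert_of_adj hl hpl, Nat.cast_succ, add_sub_right_comm, zpow_add_one₀ hCp]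
  have hrest : ∀ i ∈ U.erase p, x i / C i i ^ ((degIn T (insert l U) i : ℤ) - 1) =
      x i / C i i ^ ((degIn T U i : ℤ) - 1) := fun i hi => by
    rw [degIn_insert_of_not_adj fun hil =>
      Finset.ne_of_mem_erase hi (huniq i (Finset.mem_of_mem_erase hi) hil)]
  rw [subtreeWeight, subtreeWeight, edgesIn_insert hp hpl huniq, Finset.prod_insert hedge,
    Finset.prod_insert hl, degIn_insert_self hp hpl huniq, ← Finset.mul_prod_erase U _ hp, hpow,
    Finset.prod_congr rfl hrest,
    ← Finset.mul_prod_erase U (fun i => x i / C i i ^ ((degIn T U i : ℤ) - 1)) hp]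
  change _ * (C p l * _) = _
  field_simp
  simp

section LeafRemoval

variable [DecidableEq V]

/-- The part of `energy` contributed by the subtrees contained in `W`. -/
def energyOn (T : SimpleGraph V) (C : Matrix V V ℝ) (hC : C.IsSymm) (W : Finset V)
    (x : V → ℝ) : ℝ :=
  ∑ U ∈ subtrees T with U ⊆ W, subtreeWeight T C hC x U

theorem energyOn_univ (hC : C.IsSymm) (x : V → ℝ) :
    energyOn T C hC Finset.univ x = energy T C hC x := by
  simp [energyOn, energy, subtreeWeight]

theorem energyOn_congr (hC : C.IsSymm) {x' : V → ℝ} (h : ∀ i ∈ W, x i = x' i) :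
    energyOn T C hC W x = energyOn T C hC W x' := by
  refine Finset.sum_congr rfl fun U hU => ?_
  rw [subtreeWeight, subtreeWeight, Finset.prod_congr rfl fun i hi => by
    rw [h i ((Finset.mem_filter.1 hU).2 hi)]]

theorem energyOn_insert_leaf (hT : T.IsTree) (hC : IsParam T C) (hl : l ∉ W)
    (huniq : ∀ j ∈ W, T.Adj j l → ∀ k ∈ W, T.Adj k l → j = k) (x : V → ℝ) :
    energyOn T C hC.symm (insert l W) x = C l l * x l +
      energyOn T C hC.symm W fun j => x j * (1 + C j l / C j j * x l) := by
  classical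
  simp only [energyOn]
  convert sum_subtrees_subset_insert hT hl huniq (subtreeWeight T C hC.symm x) using 2
  · rw [subtreeWeight_singleton]
  refine Finset.sum_congr rfl fun U hU => ?_
  have hUW := (Finset.mem_filter.1 hU).2
  have hlU : l ∉ U := fun h => hl (hUW h)
  have factor_eq_one {j : V} (hj : j ∈ U) (hjl : ¬T.Adj j l) : 1 + C j l / C j j * x l = 1 := by
    simp [hC.eq_zero j l (ne_of_mem_of_not_mem hj hlU) hjl]
  rw [subtreeWeight_mul]
  split_ifs with hadj
  · obtain ⟨p, hp, hpl⟩ := hadj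
    have huniq' (j) (hj : j ∈ U) (hjl : T.Adj j l) : j = p := huniq j (hUW hj) hjl p (hUW hp) hpl
    rw [subtreeWeight_insert hC x hlU hp hpl huniq', Finset.prod_eq_single_of_mem p hp
      fun j hj hjp => factor_eq_one hj fun hjl => hjp (huniq' j hj hjl)]
    ring
  · push Not at hadj
    rw [Finset.prod_eq_one fun j hj => factor_eq_one hj (hadj j hj), mul_one, add_zero]

/-- The coordinates left after the vertices outside `W` have been removed from the tree one leaf at
a time, each removed child `i` multiplying the coordinate of its parent `j` by
`1 + C j i / C j j * Phi T C r s i`. -/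
def absorbed (T : SimpleGraph V) (C : Matrix V V ℝ) (r : V) (s : V → ℝ) (W : Finset V)
    (j : V) : ℝ :=
  s j * ∏ i ∈ children T r j with i ∉ W, (1 + C j i / C j j * Phi T C r s i)

theorem absorbed_univ (s : V → ℝ) : absorbed T C r s Finset.univ = s := by
  ext j
  simp [absorbed]

theorem absorbed_eq_Phi (h : ∀ i ∈ children T r l, i ∉ W) :
    absorbed T C r s W l = Phi T C r s l := by
  rw [absorbed, Phi_eq, Finset.filter_true_of_mem h]

theorem absorbed_insert_mul (hT : T.IsTree) (hC : IsParam T C) (hl : l ∉ W)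
    (hmax : ∀ i ∈ W, T.dist r i ≤ T.dist r l) {j : V} (hj : j ∈ W) :
    absorbed T C r s (insert l W) j * (1 + C j l / C j j * Phi T C r s l) =
      absorbed T C r s W j := by
  classical
  rw [absorbed, absorbed, mul_assoc]
  congr 1
  by_cases hjl : IsParent T r j l
  · have hfilter : (children T r j).filter (· ∉ W) =
        insert l ((children T r j).filter (· ∉ insert l W)) := by
      ext i
      have := mem_children.2 hjl
      grind
    rw [hfilter, Finset.prod_insert (by simp), mul_comm]
  · have hadj : ¬T.Adj j l := fun h => (isParent_or_isParent hT r h).elim hjl fun h' => by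
      have := h'.2
      have := hmax j hj
      omega
    rw [hC.eq_zero j l (ne_of_mem_of_not_mem hj hl) hadj, zero_div, zero_mul, add_zero, mul_one]
    refine Finset.prod_congr (Finset.filter_congr fun i hi => ?_) fun _ _ => rfl
    have : i ≠ l := fun h => hadj (h ▸ (mem_children.1 hi).1)
    simp [this]

theorem energyOn_absorbed (hT : T.IsTree) (hC : IsParam T C) (r : V) (s : V → ℝ)
    (W : Finset V) :
    energyOn T C hC.symm W (absorbed T C r s W) = ∑ i ∈ W, C i i * Phi T C r s i := by
  induction W using Finset.induction_on_max_value (T.dist r) with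
  | empty =>
    rw [energyOn, Finset.filter_false_of_mem, Finset.sum_empty, Finset.sum_empty]
    rintro U hU hU_empty
    obtain ⟨v, hv⟩ := ((mem_subtrees hT).1 hU).nonempty
    exact absurd (hU_empty hv) (Finset.notMem_empty v)
  | insert l W hl hmax ih =>
    have huniq : ∀ j ∈ W, T.Adj j l → ∀ k ∈ W, T.Adj k l → j = k := by
      have parent {j : V} (hj : j ∈ W) (hjl : T.Adj j l) : IsParent T r j l :=
        (isParent_or_isParent hT r hjl).resolve_right fun h => by
          have := h.2
          have := hmax j hj
          omega
      exact fun j hj hjl k hk hkl => (parent hj hjl).eq_left hT (parent hk hkl)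
    have hleaf : absorbed T C r s (insert l W) l = Phi T C r s l :=
      absorbed_eq_Phi fun i hi hiW => by
        have := (mem_children.1 hi).2
        have : T.dist r i ≤ T.dist r l := by
          rcases Finset.mem_insert.1 hiW with rfl | hi'
          exacts [le_rfl, hmax i hi']
        omega
    rw [energyOn_insert_leaf hT hC hl huniq, Finset.sum_insert hl, hleaf, ← ih,
      energyOn_congr hC.symm fun j hj => absorbed_insert_mul hT hC hl hmax hj]

end LeafRemoval

theorem energy_eq_sum_Phi (hT : T.IsTree) (hC : IsParam T C) (r : V) (s : V → ℝ) :
    energy T C hC.symm s = ∑ i, C i i * Phi T C r s i := by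
  classical
  rw [← energyOn_univ, ← energyOn_absorbed hT hC r s, absorbed_univ]

end Energy

section ChangeOfVariables

theorem det_eq_prod_diag_of_forall_le {n R α : Type*} [Fintype n] [DecidableEq n] [CommRing R]
    [LinearOrder α] (M : Matrix n n R) (b : n → α)
    (h : ∀ i j, i ≠ j → b j ≤ b i → M i j = 0) : M.det = ∏ i, M i i := by
  have htriangular : M.BlockTriangular b := fun i j hij => h i j (by rintro rfl; simp at hij) hij.le
  have hblock (a : α) : M.toSquareBlock b a = Matrix.diagonal fun i : {i // b i = a} => M i i := by
    ext i j
    rcases eq_or_ne i j with rfl | hij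
    · simp [Matrix.toSquareBlock_def]
    · rw [Matrix.diagonal_apply_ne _ hij]
      exact h i j (Subtype.coe_ne_coe.2 hij) (j.2.trans i.2.symm).le
  simp only [htriangular.det, hblock, Matrix.det_diagonal]
  rw [← Finset.prod_fiberwise_of_maps_to fun i _ => Finset.mem_image_of_mem b (Finset.mem_univ i)]
  exact Finset.prod_congr rfl fun a _ => (Finset.prod_subtype _ (by simp) fun i => M i i).symm

variable {V : Type*} [Fintype V] {T : SimpleGraph V} {C : Matrix V V ℝ} {r i p q : V} {y : V → ℝ}

section Update

variable [DecidableEq V]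

theorem Psi_update_self (hy : y q ≠ 0) (t : ℝ) :
    Psi T C r (Function.update y q t) q = t * (Psi T C r y q / y q) := by
  have hne : ∀ j ∈ children T r q, j ≠ q := fun j hj => (mem_children.1 hj).1.ne'
  rw [Psi, Psi, Function.update_self,
    Finset.prod_congr rfl fun j hj => by rw [Function.update_of_ne (hne j hj)]]
  field_simp

theorem Psi_update_of_notMem_children (hiq : i ≠ q) (hq : q ∉ children T r i) (t : ℝ) :
    Psi T C r (Function.update y q t) i = Psi T C r y i := by
  have hne : ∀ j ∈ children T r i, j ≠ q := fun j hj => ne_of_mem_of_not_mem hj hq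
  rw [Psi, Psi, Function.update_of_ne hiq,
    Finset.prod_congr rfl fun j hj => by rw [Function.update_of_ne (hne j hj)]]

theorem Psi_update_of_isParent (hpq : IsParent T r p q) (hy : 1 + C p q / C p p * y q ≠ 0) (t : ℝ) :
    Psi T C r (Function.update y q t) p =
      Psi T C r y p * (1 + C p q / C p p * y q) / (1 + C p q / C p p * t) := by
  have hq := mem_children.2 hpq
  rw [Psi, Psi, Function.update_of_ne hpq.1.ne, ← Finset.mul_prod_erase _ _ hq,
    ← Finset.mul_prod_erase _ (fun j => 1 + C p j / C p p * y j) hq, Function.update_self,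
    Finset.prod_congr rfl fun j hj => by rw [Function.update_of_ne (Finset.ne_of_mem_erase hj)],
    mul_comm, mul_comm (1 + C p q / C p p * y q), ← div_div, ← div_div, div_mul_cancel₀ _ hy]

end Update

theorem contDiffOn_Psi (hC : IsParam T C) (r : V) : ContDiffOn ℝ 1 (Psi T C r) (orthant V) := by
  refine contDiffOn_pi.2 fun i => ?_
  refine ContDiffOn.div (contDiff_apply ℝ ℝ i).contDiffOn (contDiffOn_prod fun j _ => ?_)
    fun y hy => (prod_children_pos hC fun j _ => hy j).ne'
  exact contDiffOn_const.add (contDiffOn_const.mul (contDiff_apply ℝ ℝ j).contDiffOn)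

theorem differentiableAt_Psi (hC : IsParam T C) (r : V) (hy : y ∈ orthant V) :
    DifferentiableAt ℝ (Psi T C r) y :=
  ((contDiffOn_Psi hC r).differentiableOn one_ne_zero).differentiableAt
    (isOpen_orthant.mem_nhds hy)

theorem fderiv_Psi_apply_single [DecidableEq V] (hC : IsParam T C) (r : V) (hy : y ∈ orthant V)
    (i j : V) : fderiv ℝ (Psi T C r) y (Pi.single j 1) i =
      deriv (fun t => Psi T C r (Function.update y j t) i) (y j) := by
  have hderiv : HasFDerivAt (Psi T C r) (fderiv ℝ (Psi T C r) y) (Function.update y j (y j)) := by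
    rw [Function.update_eq_self]
    exact (differentiableAt_Psi hC r hy).hasFDerivAt
  exact (hasDerivAt_pi.1 (hderiv.comp_hasDerivAt (y j) (hasDerivAt_update y j (y j))) i).deriv.symm

theorem det_fderiv_Psi (hC : IsParam T C) (r : V) (hy : y ∈ orthant V) :
    (fderiv ℝ (Psi T C r) y).det = ∏ i, Psi T C r y i / y i := by
  classical
  rw [ContinuousLinearMap.det, ← LinearMap.det_toMatrix',
    det_eq_prod_diag_of_forall_le _ (T.dist r)]
  · refine Finset.prod_congr rfl fun i _ => ?_
    rw [LinearMap.toMatrix'_apply, ContinuousLinearMap.coe_coe, fderiv_Psi_apply_single hC r hy]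
    simp only [Psi_update_self (hy i).ne', deriv_mul_const_field', deriv_id'', one_mul]
  · intro i j hij hdist
    have hj : j ∉ children T r i := fun hj => by
      have := (mem_children.1 hj).2
      omega
    rw [LinearMap.toMatrix'_apply, ContinuousLinearMap.coe_coe, fderiv_Psi_apply_single hC r hy]
    simp only [Psi_update_of_notMem_children hij hj, deriv_const]

theorem prod_Psi_div_pos (hC : IsParam T C) (r : V) (hy : y ∈ orthant V) :
    0 < ∏ i, Psi T C r y i / y i :=
  Finset.prod_pos fun i _ => div_pos (Psi_mem_orthant hC r hy i) (hy i)

/-- The density on the open orthant of the image under `Phi T C r` of the measure with density `f`;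
the product is the Jacobian determinant of `Psi T C r`. -/
def pushDensity (T : SimpleGraph V) (C : Matrix V V ℝ) (r : V) (f : (V → ℝ) → ℝ)
    (y : V → ℝ) : ℝ :=
  f (Psi T C r y) * ∏ i, Psi T C r y i / y i

theorem map_Phi_withDensity (hC : IsParam T C) (r : V) (f : (V → ℝ) → ℝ) :
    ((volume.restrict (orthant V)).withDensity fun x => ENNReal.ofReal (f x)).map (Phi T C r) =
      (volume.restrict (orthant V)).withDensity
        fun y => ENNReal.ofReal (pushDensity T C r f y) := by
  have hmeas : Measurable (Phi T C r) := (continuous_Phi r).measurable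
  have hinj : InjOn (Psi T C r) (orthant V) :=
    LeftInvOn.injOn (f₁' := Phi T C r) fun y hy => Phi_Psi hC r hy
  refine Measure.ext fun s hs => ?_
  rw [Measure.map_apply hmeas hs, withDensity_apply _ (hmeas hs), withDensity_apply _ hs,
    ← lintegral_indicator (hmeas hs), ← lintegral_indicator hs]
  conv_lhs => rw [← image_Psi_orthant hC r]
  rw [lintegral_image_eq_lintegral_abs_det_fderiv_mul volume measurableSet_orthant
    (fun y hy => (differentiableAt_Psi hC r hy).hasFDerivAt.hasFDerivWithinAt) hinj]
  refine setLIntegral_congr_fun measurableSet_orthant fun y hy => ?_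
  have hpos := prod_Psi_div_pos hC r hy
  have hmem : Psi T C r y ∈ Phi T C r ⁻¹' s ↔ y ∈ s := by rw [Set.mem_preimage, Phi_Psi hC r hy]
  simp only [det_fderiv_Psi hC r hy, abs_of_pos hpos]
  by_cases hys : y ∈ s
  · rw [indicator_of_mem hys, indicator_of_mem (hmem.2 hys), ← ENNReal.ofReal_mul hpos.le, mul_comm,
      pushDensity]
  · rw [indicator_of_notMem hys, indicator_of_notMem (mt hmem.1 hys), mul_zero]

end ChangeOfVariables

section Exchange

theorem comp_ae_eq_of_measurePreserving_withDensity {α : Type*} [MeasurableSpace α]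
    {μ : Measure α} [SigmaFinite μ] {e : α ≃ᵐ α} {ρ : α → ENNReal} (hρ : AEMeasurable ρ μ)
    (he : MeasurePreserving e μ μ)
    (heρ : MeasurePreserving e (μ.withDensity ρ) (μ.withDensity ρ)) : ρ ∘ e =ᵐ[μ] ρ := by
  refine (withDensity_eq_iff_of_sigmaFinite
    (hρ.comp_quasiMeasurePreserving he.quasiMeasurePreserving) hρ).1 (Measure.ext fun s hs => ?_)
  calc μ.withDensity (ρ ∘ e) s
      = ∫⁻ x in s, ρ (e x) ∂μ := withDensity_apply _ hs
    _ = ∫⁻ y in e '' s, ρ y ∂μ := he.setLIntegral_comp_emb e.measurableEmbedding ρ s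
    _ = μ.withDensity ρ (e '' s) :=
      (withDensity_apply _ (e.measurableEmbedding.measurableSet_image.2 hs)).symm
    _ = μ.withDensity ρ (e ⁻¹' (e '' s)) :=
      (heρ.measure_preimage_emb e.measurableEmbedding _).symm
    _ = μ.withDensity ρ s := by rw [preimage_image_eq s e.injective]

variable {ι α : Type*} [DecidableEq ι]

/-- The involution of pairs of vectors which exchanges their coordinates at `q`. A product measure
is characterised by the invariance of its square under these exchanges. -/
def exchange [MeasurableSpace α] (q : ι) : ((ι → α) × (ι → α)) ≃ᵐ ((ι → α) × (ι → α)) :=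
  MeasurableEquiv.ofInvolutive
    (fun z => (Function.update z.1 q (z.2 q), Function.update z.2 q (z.1 q))) (fun z => by simp)
    (by fun_prop)

theorem exchange_apply [MeasurableSpace α] (q : ι) (z : (ι → α) × (ι → α)) :
    exchange q z = (Function.update z.1 q (z.2 q), Function.update z.2 q (z.1 q)) := rfl

theorem measurePreserving_exchange [Fintype ι] [MeasurableSpace α] (ν : ι → Measure α)
    [∀ i, SigmaFinite (ν i)] (q : ι) :
    MeasurePreserving (exchange q) ((Measure.pi ν).prod (Measure.pi ν))
      ((Measure.pi ν).prod (Measure.pi ν)) := by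
  have hpair := measurePreserving_arrowProdEquivProdArrow α α ι ν ν
  have hswap : MeasurePreserving (fun z (i : ι) => (if i = q then Prod.swap else id) (z i))
      (Measure.pi fun i => (ν i).prod (ν i)) (Measure.pi fun i => (ν i).prod (ν i)) := by
    refine measurePreserving_pi _ _ fun i => ?_
    split_ifs
    exacts [Measure.measurePreserving_swap, MeasurePreserving.id _]
  convert (hpair.comp hswap).comp (hpair.symm _) using 1
  funext z
  refine Prod.ext (funext fun i => ?_) (funext fun i => ?_) <;>
  · rcases eq_or_ne i q with rfl | hi <;>
    simp [exchange_apply, MeasurableEquiv.arrowProdEquivProdArrow,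
      Equiv.arrowProdEquivProdArrow, *]

theorem ae_eq_exchange_of_withDensity_eq_pi [Fintype ι] [MeasurableSpace α] {μ ν : ι → Measure α}
    [∀ i, SigmaFinite (μ i)] [∀ i, SigmaFinite (ν i)] {ρ : (ι → α) → ENNReal}
    (hρ : AEMeasurable ρ (Measure.pi μ)) (hlaw : (Measure.pi μ).withDensity ρ = Measure.pi ν)
    (q : ι) : ∀ᵐ z ∂(Measure.pi μ).prod (Measure.pi μ),
      ρ (Function.update z.1 q (z.2 q)) * ρ (Function.update z.2 q (z.1 q)) = ρ z.1 * ρ z.2 := by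
  have hsquare : (Measure.pi ν).prod (Measure.pi ν) =
      ((Measure.pi μ).prod (Measure.pi μ)).withDensity fun z => ρ z.1 * ρ z.2 := by
    rw [← hlaw, prod_withDensity₀ hρ hρ]
  have hinv := measurePreserving_exchange ν q
  rw [hsquare] at hinv
  have hmeas : AEMeasurable (fun z => ρ z.1 * ρ z.2) ((Measure.pi μ).prod (Measure.pi μ)) :=
    (hρ.comp_quasiMeasurePreserving Measure.quasiMeasurePreserving_fst).mul
      (hρ.comp_quasiMeasurePreserving Measure.quasiMeasurePreserving_snd)
  exact comp_ae_eq_of_measurePreserving_withDensity hmeas (measurePreserving_exchange μ q) hinv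

theorem mul_eq_mul_exchange_of_withDensity_eq_pi [Fintype ι] {h : (ι → ℝ) → ℝ}
    (hpos : ∀ y ∈ orthant ι, 0 < h y) (hcont : ContinuousOn h (orthant ι)) (ν : ι → Measure ℝ)
    [∀ i, SigmaFinite (ν i)]
    (hlaw : (volume.restrict (orthant ι)).withDensity (fun y => ENNReal.ofReal (h y)) =
      Measure.pi ν) (q : ι) {y y' : ι → ℝ} (hy : y ∈ orthant ι) (hy' : y' ∈ orthant ι) :
    h (Function.update y q (y' q)) * h (Function.update y' q (y q)) = h y * h y' := by
  set S : Set ((ι → ℝ) × (ι → ℝ)) := orthant ι ×ˢ orthant ι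
  have hS : IsOpen S := isOpen_orthant.prod isOpen_orthant
  have hmaps : MapsTo (fun z => (Function.update z.1 q (z.2 q), Function.update z.2 q (z.1 q)))
      S S := fun z hz => ⟨update_mem_orthant hz.1 q (hz.2 q), update_mem_orthant hz.2 q (hz.1 q)⟩
  have hcontS : ContinuousOn (fun z => h z.1 * h z.2) S :=
    (hcont.comp continuousOn_fst fun z hz => hz.1).mul
      (hcont.comp continuousOn_snd fun z hz => hz.2)
  have hcontS' : ContinuousOn
      (fun z => h (Function.update z.1 q (z.2 q)) * h (Function.update z.2 q (z.1 q))) S :=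
    hcontS.comp (by fun_prop) hmaps
  suffices (fun z => h (Function.update z.1 q (z.2 q)) * h (Function.update z.2 q (z.1 q)))
      =ᵐ[volume.restrict S] fun z => h z.1 * h z.2 from
    Measure.eqOn_open_of_ae_eq this hS hcontS' hcontS (show (y, y') ∈ S from ⟨hy, hy'⟩)
  have hmeas := (hcont.aemeasurable (μ := volume) measurableSet_orthant).ennreal_ofReal
  rw [restrict_orthant_eq_pi] at hmeas hlaw
  have hae := ae_eq_exchange_of_withDensity_eq_pi hmeas hlaw q
  rw [← restrict_orthant_eq_pi, Measure.prod_restrict, ← Measure.volume_eq_prod] at hae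
  filter_upwards [hae, ae_restrict_mem hS.measurableSet] with z hz hzS
  obtain ⟨hz1, hz2⟩ := hmaps hzS
  rwa [← ENNReal.ofReal_mul (hpos _ hzS.1).le, ← ENNReal.ofReal_mul (hpos _ hz1).le,
    ENNReal.ofReal_eq_ofReal_iff (mul_pos (hpos _ hz1) (hpos _ hz2)).le
      (mul_pos (hpos _ hzS.1) (hpos _ hzS.2)).le] at hz

end Exchange

section EdgePoint

variable {V : Type*} [Fintype V] [DecidableEq V] {T : SimpleGraph V} {C : Matrix V V ℝ}
  {r p q : V} {x y : V → ℝ}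

theorem Psi_update (hT : T.IsTree) (hC : IsParam T C) (hpq : IsParent T r p q)
    (hy : y ∈ orthant V) (t : ℝ) :
    Psi T C r (Function.update y q t) =
      Function.update (Function.update (Psi T C r y) p
        (Psi T C r y p * (1 + C p q / C p p * y q) / (1 + C p q / C p p * t))) q
        (t * (Psi T C r y q / y q)) := by
  have hk : 0 < 1 + C p q / C p p * y q := add_pos one_pos (mul_pos (hC.ratio_pos hpq.1) (hy q))
  ext i
  rcases eq_or_ne i q with rfl | hiq
  · rw [Function.update_self, Psi_update_self (hy i).ne']
  rw [Function.update_of_ne hiq]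
  rcases eq_or_ne i p with rfl | hip
  · rw [Function.update_self, Psi_update_of_isParent hpq hk.ne']
  · rw [Function.update_of_ne hip, Psi_update_of_notMem_children hiq fun hq =>
      hip ((mem_children.1 hq).eq_left hT hpq)]

theorem Phi_update_root (hx : x r ≠ 0) (t : ℝ) :
    Phi T C r (Function.update x r t) r = t * (Phi T C r x r / x r) := by
  rw [Phi_eq_mul_div hx fun l hl => Function.update_of_ne (by rintro rfl; exact lt_irrefl _ hl) _ _,
    Function.update_self]

/-- The vector which agrees with `x` outside the edge `{p, q}` and has the transforms
`Phi T C q · p = u` and `Phi T C p · q = v` at the two ends of this edge. -/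
def edgePoint (T : SimpleGraph V) (C : Matrix V V ℝ) (p q : V) (x : V → ℝ) (u v : ℝ) : V → ℝ :=
  Function.update (Function.update x p (u / (Phi T C q x p / x p))) q (v / (Phi T C p x q / x q))

theorem edgePoint_comm (h : p ≠ q) (x : V → ℝ) (u v : ℝ) :
    edgePoint T C p q x u v = edgePoint T C q p x v u := by
  rw [edgePoint, edgePoint, Function.update_comm h]

theorem edgePoint_mem_orthant (hC : IsParam T C) (p q : V) (hx : x ∈ orthant V) {u v : ℝ}
    (hu : 0 < u) (hv : 0 < v) : edgePoint T C p q x u v ∈ orthant V :=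
  update_mem_orthant
    (update_mem_orthant hx p (div_pos hu (div_pos (Phi_mem_orthant hC q hx p) (hx p)))) q
    (div_pos hv (div_pos (Phi_mem_orthant hC p hx q) (hx q)))

theorem Phi_edgePoint_right (hC : IsParam T C) (h : T.Adj p q) (hx : x ∈ orthant V) (u v : ℝ) :
    Phi T C p (edgePoint T C p q x u v) q = v := by
  rw [Phi_eq_mul_div (s := x) (hx q).ne' fun l hl => ?_]
  · rw [edgePoint, Function.update_self]
    exact div_mul_cancel₀ _ (div_pos (Phi_mem_orthant hC p hx q) (hx q)).ne'
  · rw [edgePoint, Function.update_of_ne (by rintro rfl; exact lt_irrefl _ hl),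
      Function.update_of_ne (by rintro rfl; simp at hl)]

theorem update_eq_edgePoint (hC : IsParam T C) (h : p ≠ q) (hx : x ∈ orthant V) (t : ℝ) :
    Function.update x p t = edgePoint T C p q x (t * (Phi T C q x p / x p)) (Phi T C p x q) := by
  have hp := (div_pos (Phi_mem_orthant hC q hx p) (hx p)).ne'
  have hq := (Phi_mem_orthant hC p hx q).ne'
  rw [edgePoint, mul_div_cancel_right₀ _ hp, div_div_cancel₀ hq, eq_comm,
    Function.update_eq_self_iff, Function.update_of_ne h.symm]

theorem contDiff_edgePoint (p q : V) (x : V → ℝ) (v : ℝ) :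
    ContDiff ℝ 1 fun u => edgePoint T C p q x u v := by
  refine contDiff_pi.2 fun i => ?_
  simp only [edgePoint, Function.update_apply]
  split_ifs <;> fun_prop

end EdgePoint

section Separability

variable {V : Type*} [Fintype V] [DecidableEq V] {T : SimpleGraph V} {C : Matrix V V ℝ}
  {r r' p q : V} {L : (V → ℝ) → ℝ} {x : V → ℝ}

/-- Additive separability of `L ∘ Psi T C r` with respect to the coordinate `q`. For the logarithm
`L` of a density, this is what the independence of the components of `Phi T C r` amounts to. -/
def IsSeparable (T : SimpleGraph V) (C : Matrix V V ℝ) (r q : V) (L : (V → ℝ) → ℝ) : Prop :=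
  ∀ y ∈ orthant V, ∀ y' ∈ orthant V,
    L (Psi T C r (Function.update y q (y' q))) + L (Psi T C r (Function.update y' q (y q))) =
      L (Psi T C r y) + L (Psi T C r y')

/-- The contribution of the coordinate `q` to `L ∘ Psi T C r` when `L` is separable. -/
def childProfile (T : SimpleGraph V) (C : Matrix V V ℝ) (L : (V → ℝ) → ℝ) (r q : V) (v : ℝ) : ℝ :=
  L (Psi T C r (Function.update 1 q v)) - L (Psi T C r 1)

/-- The function `L` in terms of `s = Phi T C p · p`, on the vectors which agree with `x` outside
the edge `{p, q}` and have `Phi T C p · q = 1`. -/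
def rootProfile (T : SimpleGraph V) (C : Matrix V V ℝ) (L : (V → ℝ) → ℝ) (p q : V) (x : V → ℝ)
    (s : ℝ) : ℝ :=
  L (edgePoint T C p q x (s / (1 + C p q / C p p)) 1)

theorem differentiableOn_childProfile (hC : IsParam T C) (hL : ContDiffOn ℝ 1 L (orthant V))
    (r q : V) : DifferentiableOn ℝ (childProfile T C L r q) (Ioi 0) := by
  have hLPsi : ContDiffOn ℝ 1 (L ∘ Psi T C r) (orthant V) :=
    hL.comp (contDiffOn_Psi hC r) fun _ hy => Psi_mem_orthant hC r hy
  exact ((hLPsi.comp (contDiff_update 1 (1 : V → ℝ) q).contDiffOn fun _ hv =>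
    update_mem_orthant one_mem_orthant q hv).differentiableOn one_ne_zero).sub_const _

theorem contDiffOn_rootProfile (hC : IsParam T C) (hL : ContDiffOn ℝ 1 L (orthant V))
    (h : T.Adj p q) (hx : x ∈ orthant V) :
    ContDiffOn ℝ 1 (rootProfile T C L p q x) (Ioi 0) :=
  hL.comp ((contDiff_edgePoint p q x 1).comp (contDiff_id.div_const _)).contDiffOn fun _ hs =>
    edgePoint_mem_orthant hC p q hx (div_pos hs (add_pos one_pos (hC.ratio_pos h))) one_pos

theorem IsSeparable.eq_rootProfile_add_childProfile (hT : T.IsTree) (hC : IsParam T C)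
    (hpq : IsParent T r p q) (hL : IsSeparable T C r q L) (hx : x ∈ orthant V) {u v : ℝ}
    (hu : 0 < u) (hv : 0 < v) : L (edgePoint T C p q x u v) =
      rootProfile T C L p q x (u * (1 + C p q / C p p * v)) + childProfile T C L r q v := by
  have hpoint := edgePoint_mem_orthant (T := T) hC p q hx hu hv
  have hPhi_q : Phi T C r (edgePoint T C p q x u v) q = v := by
    rw [Phi_eq_of_isParent hT hpq, Phi_edgePoint_right hC hpq.1 hx]
  have hPhi := Phi_mem_orthant hC r hpoint
  have hmove : Psi T C r (Function.update (Phi T C r (edgePoint T C p q x u v)) q 1) =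
      edgePoint T C p q x (u * (1 + C p q / C p p * v) / (1 + C p q / C p p)) 1 := by
    rw [Psi_update hT hC hpq hPhi, Psi_Phi hC r hpoint, hPhi_q]
    ext i
    simp only [edgePoint, Function.update_apply, hpq.1.ne, if_true, if_false]
    split_ifs
    · field_simp
    · ring
    · rfl
  have hsep := hL _ hPhi 1 one_mem_orthant
  rw [Pi.one_apply, hmove, hPhi_q, Psi_Phi hC r hpoint] at hsep
  rw [rootProfile, childProfile]
  linarith

theorem IsSeparable.hasDerivAt_update (hT : T.IsTree) (hC : IsParam T C)
    (hL : ContDiffOn ℝ 1 L (orthant V)) (hpq : IsParent T r p q) (hsep : IsSeparable T C r q L)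
    (hx : x ∈ orthant V) : HasDerivAt (fun t => L (Function.update x p t))
      (Phi T C p x p * deriv (rootProfile T C L p q x) (Phi T C p x p) / x p) (x p) := by
  have hroot := Phi_mem_orthant hC p hx p
  have hslope : x p * (Phi T C p x p / x p) = Phi T C p x p := mul_div_cancel₀ _ (hx p).ne'
  have hprofile : HasDerivAt (rootProfile T C L p q x)
      (deriv (rootProfile T C L p q x) (Phi T C p x p)) (x p * (Phi T C p x p / x p)) := by
    rw [hslope]
    exact (((contDiffOn_rootProfile hC hL hpq.1 hx).differentiableOn one_ne_zero).differentiableAt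
      (Ioi_mem_nhds hroot)).hasDerivAt
  have hcomp := (hprofile.comp (x p) ((hasDerivAt_id (x p)).mul_const
    (Phi T C p x p / x p))).add_const (childProfile T C L r q (Phi T C p x q))
  refine (hcomp.congr_of_eventuallyEq ?_).congr_deriv (by ring)
  filter_upwards [Ioi_mem_nhds (hx p)] with t ht
  rw [update_eq_edgePoint hC hpq.1.ne hx, hsep.eq_rootProfile_add_childProfile hT hC hpq hx
    (mul_pos ht (div_pos (Phi_mem_orthant hC q hx p) (hx p))) (Phi_mem_orthant hC p hx q),
    Function.comp_apply, Phi_root_eq_mul (C := C) hT hpq.1]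
  congr 2
  simp only [id]
  ring

theorem IsSeparable.exists_euler_profiles (hT : T.IsTree) (hC : IsParam T C)
    (hL : ContDiffOn ℝ 1 L (orthant V)) (hpq : IsParent T r p q) (hqp : IsParent T r' q p)
    (hsep : IsSeparable T C r q L) (hsep' : IsSeparable T C r' p L) (hx : x ∈ orthant V) :
    ∃ A B c, (∀ s > 0, s * deriv (rootProfile T C L p q x) s = A - c * (C q p / C q q) * s) ∧
      (∀ s > 0, s * deriv (rootProfile T C L q p x) s = B - c * (C p q / C p p) * s) ∧
      ∀ v > 0, (1 + C p q / C p p * v) * (v * deriv (childProfile T C L r q) v) =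
        (1 + C p q / C p p * v) * (B - c * (C p q / C p p) * v) - A * (C p q / C p p) * v := by
  refine exists_euler_derivative_of_separation (hC.ratio_pos hpq.1) (hC.ratio_pos hqp.1)
    (contDiffOn_rootProfile hC hL hpq.1 hx) (differentiableOn_childProfile hC hL r' p)
    (differentiableOn_childProfile hC hL r q) (contDiffOn_rootProfile hC hL hqp.1 hx)
    fun u hu v hv => ?_
  rw [← hsep.eq_rootProfile_add_childProfile hT hC hpq hx hu hv, edgePoint_comm hpq.1.ne,
    hsep'.eq_rootProfile_add_childProfile hT hC hqp hx hv hu, add_comm]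

end Separability

section Gradient

variable {V : Type*} [Fintype V] [DecidableEq V] {T : SimpleGraph V} {C : Matrix V V ℝ}
  {r r' p q : V} {L : (V → ℝ) → ℝ} {x : V → ℝ}

/-- The partial derivative of `L` at the vertex `p` is that of the logarithmic tree-Kummer density
`x ↦ ∑ i, a i * log (x i) - c * energy T C _ x` with `a p = A`. -/
def HasKummerPartial (T : SimpleGraph V) (C : Matrix V V ℝ) (L : (V → ℝ) → ℝ) (p : V)
    (A c : ℝ) : Prop :=
  ∀ x ∈ orthant V, HasDerivAt (fun t => L (Function.update x p t))
    ((A - c * (C p p * Phi T C p x p)) / x p) (x p)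

-- The profile of the child does not depend on `x`, so neither do the coefficients it determines.
theorem IsSeparable.exists_uniform_euler_rootProfiles (hT : T.IsTree) (hC : IsParam T C)
    (hL : ContDiffOn ℝ 1 L (orthant V)) (hpq : IsParent T r p q) (hqp : IsParent T r' q p)
    (hsep : IsSeparable T C r q L) (hsep' : IsSeparable T C r' p L) :
    ∃ A B c, ∀ x ∈ orthant V,
      (∀ s > 0, s * deriv (rootProfile T C L p q x) s = A - c * (C q p / C q q) * s) ∧
      ∀ s > 0, s * deriv (rootProfile T C L q p x) s = B - c * (C p q / C p p) * s := by
  obtain ⟨A, B, c, -, -, hchild⟩ :=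
    hsep.exists_euler_profiles hT hC hL hpq hqp hsep' one_mem_orthant
  refine ⟨A, B, c, fun x hx => ?_⟩
  obtain ⟨A', B', c', hroot, hroot', hchild'⟩ :=
    hsep.exists_euler_profiles hT hC hL hpq hqp hsep' hx
  obtain ⟨rfl, rfl, rfl⟩ := euler_coefficients_unique (hC.ratio_pos hpq.1) fun v hv =>
    (hchild v hv).symm.trans (hchild' v hv)
  exact ⟨hroot, hroot'⟩

theorem IsSeparable.exists_hasKummerPartial (hT : T.IsTree) (hC : IsParam T C)
    (hL : ContDiffOn ℝ 1 L (orthant V)) (hpq : IsParent T r p q) (hqp : IsParent T r' q p)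
    (hsep : IsSeparable T C r q L) (hsep' : IsSeparable T C r' p L) :
    ∃ A B c, HasKummerPartial T C L p A c ∧ HasKummerPartial T C L q B c := by
  obtain ⟨A, B, c, heuler⟩ :=
    hsep.exists_uniform_euler_rootProfiles hT hC hL hpq hqp hsep'
  have hp := (hC.diag_pos p).ne'
  have hq := (hC.diag_pos q).ne'
  refine ⟨A, B, c * (C p q / (C p p * C q q)), fun x hx => ?_, fun x hx => ?_⟩
  · refine (hsep.hasDerivAt_update hT hC hL hpq hx).congr_deriv ?_
    rw [(heuler x hx).1 _ (Phi_mem_orthant hC p hx p), hC.symm.apply p q]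
    field_simp
  · refine (hsep'.hasDerivAt_update hT hC hL hqp hx).congr_deriv ?_
    rw [(heuler x hx).2 _ (Phi_mem_orthant hC q hx q)]
    field_simp

theorem HasKummerPartial.unique (hC : IsParam T C) {A c A' c' : ℝ}
    (h : HasKummerPartial T C L p A c) (h' : HasKummerPartial T C L p A' c') :
    A = A' ∧ c = c' := by
  have heq (x) (hx : x ∈ orthant V) :
      A - c * (C p p * Phi T C p x p) = A' - c' * (C p p * Phi T C p x p) :=
    (div_left_inj' (hx p).ne').1 ((h x hx).unique (h' x hx))
  have hone := heq 1 one_mem_orthant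
  have htwo := heq _ (update_mem_orthant one_mem_orthant p two_pos)
  rw [Phi_update_root (x := 1) (by simp), Pi.one_apply, div_one] at htwo
  have hpos : 0 < C p p * Phi T C p 1 p :=
    mul_pos (hC.diag_pos p) (Phi_mem_orthant hC p one_mem_orthant p)
  have hc : c = c' := mul_right_cancel₀ hpos.ne' (by linarith)
  subst hc
  exact ⟨by linarith, rfl⟩

theorem exists_forall_hasKummerPartial [DecidableRel T.Adj] (hT : T.IsTree)
    (hcard : 2 ≤ Fintype.card V) (hC : IsParam T C) (hL : ContDiffOn ℝ 1 L (orthant V))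
    (hsep : ∀ r, T.degree r = 1 → ∀ q, IsSeparable T C r q L) :
    ∃ (a : V → ℝ) (c : ℝ), ∀ p, HasKummerPartial T C L p (a p) c := by
  have hedge (p q) (h : T.Adj p q) :
      ∃ A B c, HasKummerPartial T C L p A c ∧ HasKummerPartial T C L q B c := by
    obtain ⟨r, hr, hpq⟩ := exists_leaf_isParent hT h
    obtain ⟨r', hr', hqp⟩ := exists_leaf_isParent hT h.symm
    exact (hsep r hr q).exists_hasKummerPartial hT hC hL hpq hqp (hsep r' hr' p)
  have : Nontrivial V := Fintype.one_lt_card_iff_nontrivial.1 hcard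
  have hvertex (p) : ∃ A c, HasKummerPartial T C L p A c := by
    obtain ⟨q, hq⟩ := hT.connected.preconnected.exists_adj_of_nontrivial p
    obtain ⟨A, -, c, hp, -⟩ := hedge p q hq
    exact ⟨A, c, hp⟩
  choose a c hac using hvertex
  obtain ⟨p₀⟩ := hT.connected.nonempty
  have hconst (p) : c p = c p₀ := by
    obtain ⟨w⟩ := hT.connected.preconnected p p₀
    induction w with
    | nil => rfl
    | cons hadj _ ih =>
      obtain ⟨A, B, c', hp, hq⟩ := hedge _ _ hadj
      rw [← ih, ((hac _).unique hC hp).2, ((hac _).unique hC hq).2]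
  exact ⟨a, c p₀, fun p => hconst p ▸ hac p⟩

theorem hasDerivAt_energy_update (hT : T.IsTree) (hC : IsParam T C) (p : V) (hx : x ∈ orthant V) :
    HasDerivAt (fun t => energy T C hC.symm (Function.update x p t))
      (C p p * (Phi T C p x p / x p)) (x p) := by
  have hPhi (i) (hi : i ≠ p) (t : ℝ) : Phi T C p (Function.update x p t) i = Phi T C p x i := by
    refine Phi_congr fun l hl => Function.update_of_ne ?_ _ _
    rintro rfl
    rw [SimpleGraph.dist_self, Nat.le_zero, hT.connected.dist_eq_zero_iff] at hl
    exact hi hl.symm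
  have henergy (t : ℝ) : energy T C hC.symm (Function.update x p t) =
      C p p * (t * (Phi T C p x p / x p)) +
        ∑ i ∈ Finset.univ.erase p, C i i * Phi T C p x i := by
    rw [energy_eq_sum_Phi hT hC p, ← Finset.add_sum_erase _ _ (Finset.mem_univ p),
      Phi_update_root (hx p).ne',
      Finset.sum_congr rfl fun i hi => by rw [hPhi i (Finset.ne_of_mem_erase hi)]]
  simp only [henergy]
  exact ((((hasDerivAt_id (x p)).mul_const (Phi T C p x p / x p)).const_mul
    (C p p)).add_const _).congr_deriv (by rw [one_mul])

theorem hasDerivAt_sum_mul_log_update (a : V → ℝ) (hx : x p ≠ 0) :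
    HasDerivAt (fun t => ∑ i, a i * Real.log (Function.update x p t i)) (a p / x p) (x p) := by
  have hsum (t : ℝ) : ∑ i, a i * Real.log (Function.update x p t i) =
      a p * Real.log t + ∑ i ∈ Finset.univ.erase p, a i * Real.log (x i) := by
    rw [← Finset.add_sum_erase _ _ (Finset.mem_univ p), Function.update_self,
      Finset.sum_congr rfl fun i hi => by rw [Function.update_of_ne (Finset.ne_of_mem_erase hi)]]
  simp only [hsum]
  exact ((Real.hasDerivAt_log hx).const_mul (a p)).add_const _

end Gradient

section LogDensity

variable {V : Type*} [DecidableEq V]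

theorem eq_of_forall_hasDerivAt_update_zero [Finite V] {E : Type*} [NormedAddCommGroup E]
    [NormedSpace ℝ E] {D : (V → ℝ) → E}
    (hD : ∀ x ∈ orthant V, ∀ i, HasDerivAt (fun t => D (Function.update x i t)) 0 (x i))
    {x y : V → ℝ} (hx : x ∈ orthant V) (hy : y ∈ orthant V) : D x = D y := by
  cases nonempty_fintype V
  have hupdate {z} (hz : z ∈ orthant V) (i) {t : ℝ} (ht : 0 < t) :
      D (Function.update z i t) = D z := by
    have hderiv (s) (hs : s ∈ Ioi (0 : ℝ)) : HasDerivAt (fun t => D (Function.update z i t)) 0 s :=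
      by simpa using hD _ (update_mem_orthant hz i hs) i
    simpa using isOpen_Ioi.is_const_of_deriv_eq_zero isPreconnected_Ioi
      (fun s hs => (hderiv s hs).differentiableAt.differentiableWithinAt)
      (fun s hs => (hderiv s hs).deriv) ht (hz i)
  have hpiecewise (S : Finset V) :
      D (S.piecewise x y) = D y ∧ S.piecewise x y ∈ orthant V := by
    induction S using Finset.induction_on with
    | empty => simpa using hy
    | insert i S _ ih =>
      rw [Finset.piecewise_insert]
      exact ⟨(hupdate ih.2 i (hx i)).trans ih.1, update_mem_orthant ih.2 i (hx i)⟩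
  simpa using (hpiecewise Finset.univ).1

theorem exists_eq_sum_mul_log_sub_energy [Fintype V] {T : SimpleGraph V} [DecidableRel T.Adj]
    {C : Matrix V V ℝ} (hT : T.IsTree) (hcard : 2 ≤ Fintype.card V) (hC : IsParam T C)
    {L : (V → ℝ) → ℝ} (hL : ContDiffOn ℝ 1 L (orthant V))
    (hsep : ∀ r, T.degree r = 1 → ∀ q, IsSeparable T C r q L) :
    ∃ (a : V → ℝ) (c b : ℝ), ∀ x ∈ orthant V,
      L x = b + (∑ i, a i * Real.log (x i) - c * energy T C hC.symm x) := by
  obtain ⟨a, c, hpartial⟩ := exists_forall_hasKummerPartial hT hcard hC hL hsep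
  set K : (V → ℝ) → ℝ := fun x => ∑ i, a i * Real.log (x i) - c * energy T C hC.symm x
  have hdiff (x) (hx : x ∈ orthant V) (p) :
      HasDerivAt (fun t => (L - K) (Function.update x p t)) 0 (x p) :=
    ((hpartial p x hx).sub ((hasDerivAt_sum_mul_log_update a (hx p).ne').sub
      ((hasDerivAt_energy_update hT hC p hx).const_mul c))).congr_deriv (by ring)
  exact ⟨a, c, (L - K) 1, fun x hx => sub_eq_iff_eq_add.1
    (eq_of_forall_hasDerivAt_update_zero hdiff hx one_mem_orthant)⟩

end LogDensity

section ProductDensity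

open scoped ENNReal

theorem lintegral_pi_fin_prod {n : ℕ} {E : Fin n → Type*} {mE : ∀ i, MeasurableSpace (E i)}
    {μ : ∀ i, Measure (E i)} [∀ i, SigmaFinite (μ i)] {f : ∀ i, E i → ℝ≥0∞}
    (hf : ∀ i, Measurable (f i)) :
    ∫⁻ x, ∏ i, f i (x i) ∂Measure.pi μ = ∏ i, ∫⁻ x, f i x ∂μ i := by
  induction n with
  | zero => simp
  | succ n ih =>
    have htail : Measurable fun x : ∀ i : Fin n, E i.succ => ∏ i : Fin n, f i.succ (x i) :=
      Finset.measurable_prod _ fun i _ => (hf i.succ).comp (measurable_pi_apply i)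
    rw [Fin.prod_univ_succ, ← ih fun i => hf i.succ,
      ← lintegral_prod_mul (hf 0).aemeasurable htail.aemeasurable,
      ← (measurePreserving_piFinSuccAbove μ 0).symm.lintegral_comp_emb
        (MeasurableEquiv.measurableEmbedding _)]
    refine lintegral_congr fun x => ?_
    rw [Fin.prod_univ_succ]
    rfl

variable {ι : Type*} [Fintype ι] {E : ι → Type*} {mE : ∀ i, MeasurableSpace (E i)}
  {μ : ∀ i, Measure (E i)} [∀ i, SigmaFinite (μ i)] {f : ∀ i, E i → ℝ≥0∞}

theorem lintegral_pi_prod (hf : ∀ i, Measurable (f i)) :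
    ∫⁻ x, ∏ i, f i (x i) ∂Measure.pi μ = ∏ i, ∫⁻ x, f i x ∂μ i := by
  let e := (Fintype.equivFin ι).symm
  rw [← (measurePreserving_piCongrLeft _ e).lintegral_comp_emb
    (MeasurableEquiv.measurableEmbedding _)]
  simp_rw [← e.prod_comp, MeasurableEquiv.coe_piCongrLeft, Equiv.piCongrLeft_apply_apply]
  exact lintegral_pi_fin_prod fun i => hf _

theorem pi_withDensity (hf : ∀ i, Measurable (f i)) [∀ i, SigmaFinite ((μ i).withDensity (f i))] :
    Measure.pi (fun i => (μ i).withDensity (f i)) =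
      (Measure.pi μ).withDensity fun x => ∏ i, f i (x i) := by
  refine Measure.pi_eq fun s hs => ?_
  rw [withDensity_apply _ (MeasurableSet.univ_pi hs), Measure.restrict_pi_pi, lintegral_pi_prod hf]
  exact Finset.prod_congr rfl fun i _ => (withDensity_apply _ (hs i)).symm

end ProductDensity

section Normalize

open scoped ENNReal

variable {Ω α : Type*} [MeasurableSpace Ω] [MeasurableSpace α] {P : Measure Ω}
  [IsProbabilityMeasure P] {X : Ω → α} {κ : ℝ≥0∞} {μ : Measure α}

theorem smul_eq_normalize (h : κ * μ univ = 1) : κ • μ = normalize μ := by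
  rw [normalize, ENNReal.eq_inv_of_mul_eq_one_left h]

theorem mul_measure_univ_of_hasLaw_smul (h : HasLaw X (κ • μ) P) : κ * μ univ = 1 :=
  (h.isProbabilityMeasure_iff.1 inferInstance).measure_univ

theorem hasLaw_normalize_of_smul (h : HasLaw X (κ • μ) P) : HasLaw X (normalize μ) P :=
  smul_eq_normalize (mul_measure_univ_of_hasLaw_smul h) ▸ h

theorem measure_univ_ne_top_of_hasLaw_smul (h : HasLaw X (κ • μ) P) : μ univ ≠ ∞ := by
  have hone := mul_measure_univ_of_hasLaw_smul h
  have hκ : κ ≠ 0 := left_ne_zero_of_mul (hone ▸ one_ne_zero)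
  intro htop
  rw [htop, ENNReal.mul_top hκ] at hone
  exact ENNReal.top_ne_one hone

end Normalize

section HalfLine

variable {g g' : ℝ → ℝ} {a b k : ℝ}

/-- The measure on `(0, ∞)` with density `g` with respect to Lebesgue measure; it carries the
unnormalized gamma and Kummer densities. -/
def halfLine (g : ℝ → ℝ) : Measure ℝ :=
  (volume.restrict (Ioi 0)).withDensity fun x => ENNReal.ofReal (g x)

instance sigmaFinite_halfLine (g : ℝ → ℝ) : SigmaFinite (halfLine g) :=
  SigmaFinite.withDensity_ofReal _

theorem halfLine_eq_smul (hb : 0 ≤ b) (h : ∀ x > 0, g x = b * g' x) :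
    halfLine g = ENNReal.ofReal b • halfLine g' := by
  rw [halfLine, halfLine, ← withDensity_smul' _ _ ENNReal.ofReal_ne_top]
  refine withDensity_congr_ae ?_
  filter_upwards [ae_restrict_mem measurableSet_Ioi] with x hx
  rw [Pi.smul_apply, smul_eq_mul, h x hx, ENNReal.ofReal_mul hb]

theorem map_const_mul_halfLine (hk : 0 < k) (g : ℝ → ℝ) :
    (halfLine g).map (k * ·) = halfLine fun x => k⁻¹ * g (k⁻¹ * x) := by
  have hmeas : Measurable fun x : ℝ => k * x := measurable_const_mul k
  have himage : (k⁻¹ * ·) '' Ioi (0 : ℝ) = Ioi 0 := by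
    rw [image_mul_left_Ioi (inv_pos.2 hk), mul_zero]
  refine Measure.ext fun s hs => ?_
  rw [Measure.map_apply hmeas hs, halfLine, halfLine, withDensity_apply _ (hmeas hs),
    withDensity_apply _ hs, ← lintegral_indicator (hmeas hs), ← lintegral_indicator hs]
  conv_lhs => rw [← himage]
  rw [lintegral_image_eq_lintegral_abs_deriv_mul measurableSet_Ioi
    (fun x _ => (hasDerivAt_const_mul k⁻¹).hasDerivWithinAt)
    (mul_right_injective₀ (inv_pos.2 hk).ne').injOn]
  refine lintegral_congr fun x => ?_
  have hmem : k⁻¹ * x ∈ (fun x => k * x) ⁻¹' s ↔ x ∈ s := by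
    rw [Set.mem_preimage, mul_inv_cancel_left₀ hk.ne']
  by_cases hx : x ∈ s
  · rw [indicator_of_mem hx, indicator_of_mem (hmem.2 hx), abs_of_pos (inv_pos.2 hk),
      ← ENNReal.ofReal_mul (inv_pos.2 hk).le]
  · rw [indicator_of_notMem hx, indicator_of_notMem (mt hmem.1 hx), mul_zero]

theorem integrableOn_of_halfLine_univ_ne_top (hg : Measurable g) (hpos : ∀ x > 0, 0 ≤ g x)
    (h : halfLine g univ ≠ ⊤) : IntegrableOn g (Ioi 0) := by
  rw [halfLine, withDensity_apply _ MeasurableSet.univ, Measure.restrict_univ] at h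
  refine ⟨hg.aestronglyMeasurable, ?_⟩
  rw [hasFiniteIntegral_iff_ofReal ((ae_restrict_mem measurableSet_Ioi).mono hpos)]
  exact h.lt_top

theorem shape_pos_of_integrableOn
    (h : IntegrableOn (fun x : ℝ => x ^ (a - 1) * Real.exp (-(b * x))) (Ioi 0)) : 0 < a := by
  have hrpow : IntegrableOn (fun x : ℝ => x ^ (a - 1)) (Ioo 0 1) := by
    refine ((h.mono_set Ioo_subset_Ioi_self).const_mul (Real.exp |b|)).mono' (by fun_prop) ?_
    filter_upwards [ae_restrict_mem measurableSet_Ioo] with x ⟨hx₀, hx₁⟩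
    have hbx : b * x ≤ |b| :=
      (mul_le_mul_of_nonneg_right (le_abs_self b) hx₀.le).trans
        (mul_le_of_le_one_right (abs_nonneg b) hx₁.le)
    have hexp : 1 ≤ Real.exp |b| * Real.exp (-(b * x)) := by
      rw [← Real.exp_add]
      exact Real.one_le_exp (by linarith)
    rw [Real.norm_of_nonneg (by positivity), mul_left_comm]
    exact le_mul_of_one_le_right (by positivity) hexp
  rw [intervalIntegral.integrableOn_Ioo_rpow_iff one_pos] at hrpow
  linarith

theorem rate_pos_of_integrableOn
    (h : IntegrableOn (fun x : ℝ => x ^ (a - 1) * Real.exp (-(b * x))) (Ioi 0)) : 0 < b := by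
  have ha := shape_pos_of_integrableOn h
  by_contra! hb
  have hrpow : IntegrableOn (fun x : ℝ => x ^ (a - 1)) (Ioi 1) := by
    refine (h.mono_set (Ioi_subset_Ioi zero_le_one)).mono' (by fun_prop) ?_
    filter_upwards [ae_restrict_mem measurableSet_Ioi] with x hx
    have hx₀ : 0 < x := zero_lt_one.trans hx
    rw [Real.norm_of_nonneg (by positivity)]
    refine le_mul_of_one_le_right (by positivity) (Real.one_le_exp ?_)
    exact neg_nonneg.2 (mul_nonpos_of_nonpos_of_nonneg hb hx₀.le)
  rw [integrableOn_Ioi_rpow_iff one_pos] at hrpow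
  linarith

theorem gammaMeasure_eq_smul_halfLine (ha : 0 < a) (hb : 0 < b) :
    gammaMeasure a b = ENNReal.ofReal (b ^ a / Real.Gamma a) •
      halfLine fun x => x ^ (a - 1) * Real.exp (-(b * x)) := by
  have hconst : 0 ≤ b ^ a / Real.Gamma a := (div_pos (by positivity) (Real.Gamma_pos_of_pos ha)).le
  have hcompl : volume.withDensity (gammaPDF a b) (Ioi 0)ᶜ = 0 := by
    rw [compl_Ioi, withDensity_apply _ measurableSet_Iic, setLIntegral_congr Iio_ae_eq_Iic.symm]
    exact lintegral_gammaPDF_of_nonpos le_rfl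
  have hrestrict : gammaMeasure a b =
      (volume.restrict (Ioi 0)).withDensity (gammaPDF a b) := by
    rw [← restrict_withDensity measurableSet_Ioi, gammaMeasure,
      Measure.restrict_eq_self_of_ae_mem (s := Ioi 0) (mem_ae_iff.2 hcompl)]
  rw [hrestrict, ← halfLine_eq_smul (g := fun x => b ^ a / Real.Gamma a * x ^ (a - 1) *
    Real.exp (-(b * x))) hconst (fun x _ => by ring), halfLine]
  refine withDensity_congr_ae ?_
  filter_upwards [ae_restrict_mem measurableSet_Ioi] with x hx
  exact gammaPDF_of_nonneg (le_of_lt hx)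

theorem map_const_mul_halfLine_kummer {a' : ℝ} (hk : 0 < k) :
    (halfLine fun x => x ^ (a - 1) * Real.exp (-(b * x)) / (1 + k * x) ^ a').map (k * ·) =
      ENNReal.ofReal (k⁻¹ ^ a) • halfLine fun x =>
        x ^ (a - 1) / (1 + x) ^ (a + (a' - a)) * Real.exp (-(b / k * x)) := by
  rw [map_const_mul_halfLine hk]
  refine halfLine_eq_smul (by positivity) fun x hx => ?_
  have hpow : k⁻¹ ^ a = k⁻¹ * k⁻¹ ^ (a - 1) := by
    rw [Real.rpow_sub_one (by positivity), mul_div_cancel₀ _ (inv_pos.2 hk).ne']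
  rw [mul_inv_cancel_left₀ hk.ne', hpow, Real.mul_rpow (by positivity) hx.le, add_sub_cancel]
  ring_nf

variable {Ω : Type*} [MeasurableSpace Ω] {P : Measure Ω} [IsProbabilityMeasure P] {Z : Ω → ℝ}
  {κ : ENNReal}

theorem pos_and_pos_of_hasLaw_smul_halfLine
    (hZ : HasLaw Z (κ • halfLine fun x => x ^ (a - 1) * Real.exp (-(b * x))) P) :
    0 < a ∧ 0 < b := by
  have hint := integrableOn_of_halfLine_univ_ne_top (by fun_prop) (fun x _ => by positivity)
    (measure_univ_ne_top_of_hasLaw_smul hZ)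
  exact ⟨shape_pos_of_integrableOn hint, rate_pos_of_integrableOn hint⟩

theorem hasLaw_gammaMeasure_of_smul_halfLine
    (hZ : HasLaw Z (κ • halfLine fun x => x ^ (a - 1) * Real.exp (-(b * x))) P) :
    HasLaw Z (gammaMeasure a b) P := by
  obtain ⟨ha, hb⟩ := pos_and_pos_of_hasLaw_smul_halfLine hZ
  have hgamma := gammaMeasure_eq_smul_halfLine ha hb
  have hmass := (isProbabilityMeasure_gammaMeasure ha hb).measure_univ
  rw [hgamma] at hmass
  rw [hgamma, smul_eq_normalize hmass]
  exact hasLaw_normalize_of_smul hZ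

theorem hasLaw_kummerMeasure_of_smul_halfLine {a' : ℝ} (hk : 0 < k)
    (hZ : HasLaw Z (κ • halfLine fun x =>
      x ^ (a - 1) * Real.exp (-(b * x)) / (1 + k * x) ^ a') P) :
    HasLaw (fun ω => k * Z ω) (kummerMeasure a (a' - a) (b / k)) P := by
  refine hasLaw_normalize_of_smul (κ := κ * ENNReal.ofReal (k⁻¹ ^ a)) (HasLaw.comp ⟨?_, ?_⟩ hZ)
  · exact (measurable_const_mul k).aemeasurable
  · rw [Measure.map_smul, map_const_mul_halfLine_kummer hk, smul_smul, halfLine]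

end HalfLine

section Scaling

variable {V : Type*} {T : SimpleGraph V} {C : Matrix V V ℝ} {c : ℝ}

theorem IsParam.smul (hC : IsParam T C) (hc : 0 < c) : IsParam T (c • C) where
  symm := hC.symm.smul c
  diag_pos i := mul_pos hc (hC.diag_pos i)
  edge_pos i j h := mul_pos hc (hC.edge_pos i j h)
  eq_zero i j h h' := by rw [Matrix.smul_apply, hC.eq_zero i j h h', smul_zero]

variable [Fintype V]

theorem Phi_smul (hc : c ≠ 0) (r : V) (s : V → ℝ) (i : V) :
    Phi T (c • C) r s i = Phi T C r s i := by
  induction i using children_induction T r with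
  | _ i ih =>
    rw [Phi_eq, Phi_eq T C, Finset.prod_congr rfl fun j hj => by
      rw [ih j hj, Matrix.smul_apply, Matrix.smul_apply, smul_eq_mul, smul_eq_mul,
        mul_div_mul_left _ _ hc]]

theorem energy_smul (hT : T.IsTree) (hC : IsParam T C) (hc : 0 < c) (x : V → ℝ) :
    energy T (c • C) (hC.symm.smul c) x = c * energy T C hC.symm x := by
  obtain ⟨r⟩ := hT.connected.nonempty
  rw [energy_eq_sum_Phi hT hC r, energy_eq_sum_Phi hT (hC.smul hc) r, Finset.mul_sum]
  refine Finset.sum_congr rfl fun i _ => ?_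
  rw [Phi_smul hc.ne', Matrix.smul_apply, smul_eq_mul, mul_assoc]

end Scaling

section Independence

theorem sum_update_add_sum_update {ι α M : Type*} [Fintype ι] [DecidableEq ι] [AddCommMonoid M]
    (g : α → M) (y y' : ι → α) (q : ι) :
    ∑ i, g (Function.update y q (y' q) i) + ∑ i, g (Function.update y' q (y q) i) =
      ∑ i, g (y i) + ∑ i, g (y' i) := by
  rw [← Finset.sum_add_distrib, ← Finset.sum_add_distrib]
  refine Finset.sum_congr rfl fun i _ => ?_
  rcases eq_or_ne i q with rfl | hi
  · rw [Function.update_self, Function.update_self, add_comm]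
  · rw [Function.update_of_ne hi, Function.update_of_ne hi]

variable {V : Type*} [Fintype V] {T : SimpleGraph V} {C : Matrix V V ℝ} {r : V}
  {f : (V → ℝ) → ℝ}

theorem pushDensity_pos (hC : IsParam T C) (hf : ∀ x ∈ orthant V, 0 < f x) {y : V → ℝ}
    (hy : y ∈ orthant V) : 0 < pushDensity T C r f y :=
  mul_pos (hf _ (Psi_mem_orthant hC r hy)) (prod_Psi_div_pos hC r hy)

theorem continuousOn_pushDensity (hC : IsParam T C) (hf : ContinuousOn f (orthant V)) :
    ContinuousOn (pushDensity T C r f) (orthant V) := by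
  have hPsi : ContinuousOn (Psi T C r) (orthant V) := (contDiffOn_Psi hC r).continuousOn
  exact (hf.comp hPsi fun y hy => Psi_mem_orthant hC r hy).mul
    (continuousOn_finsetProd _ fun i _ => ((continuous_apply i).comp_continuousOn hPsi).div
      (continuous_apply i).continuousOn fun y hy => (hy i).ne')

theorem log_pushDensity (hC : IsParam T C) (hf : ∀ x ∈ orthant V, 0 < f x) {y : V → ℝ}
    (hy : y ∈ orthant V) :
    Real.log (pushDensity T C r f y) = Real.log (f (Psi T C r y)) +
      ∑ i, Real.log (Psi T C r y i) - ∑ i, Real.log (y i) := by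
  have hPsi := Psi_mem_orthant hC r hy
  rw [pushDensity, Real.log_mul (hf _ hPsi).ne' (prod_Psi_div_pos hC r hy).ne',
    Real.log_prod fun i _ => (div_pos (hPsi i) (hy i)).ne',
    Finset.sum_congr rfl fun i _ => Real.log_div (hPsi i).ne' (hy i).ne',
    Finset.sum_sub_distrib, add_sub_assoc]

variable {Ω : Type*} [MeasurableSpace Ω] {P : Measure Ω} [IsProbabilityMeasure P]
  {X : Ω → V → ℝ}

theorem withDensity_pushDensity_eq_pi (hC : IsParam T C)
    (hX : HasLaw X ((volume.restrict (orthant V)).withDensity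
      fun x => ENNReal.ofReal (f x)) P)
    (hindep : iIndepFun (fun i ω => Phi T C r (X ω) i) P) :
    (volume.restrict (orthant V)).withDensity (fun y => ENNReal.ofReal (pushDensity T C r f y)) =
      Measure.pi fun i => P.map fun ω => Phi T C r (X ω) i := by
  have hPhi : Measurable (Phi T C r) := (continuous_Phi r).measurable
  have hcoord (i) : AEMeasurable (fun ω => Phi T C r (X ω) i) P :=
    ((measurable_pi_apply i).comp hPhi).comp_aemeasurable hX.aemeasurable
  rw [← map_Phi_withDensity hC r f, ← hX.map_eq,
    AEMeasurable.map_map_of_aemeasurable hPhi.aemeasurable hX.aemeasurable]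
  exact (iIndepFun_iff_map_fun_eq_pi_map hcoord).1 hindep

variable [DecidableEq V]

theorem isSeparable_of_iIndepFun (hC : IsParam T C) (hf_pos : ∀ x ∈ orthant V, 0 < f x)
    (hf : ContinuousOn f (orthant V))
    (hX : HasLaw X ((volume.restrict (orthant V)).withDensity
      fun x => ENNReal.ofReal (f x)) P)
    (hindep : iIndepFun (fun i ω => Phi T C r (X ω) i) P) (q : V) :
    IsSeparable T C r q fun x => Real.log (f x) + ∑ i, Real.log (x i) := by
  intro y hy y' hy'
  have hpos {z} (hz : z ∈ orthant V) := (pushDensity_pos (r := r) hC hf_pos hz).ne'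
  have hz : Function.update y q (y' q) ∈ orthant V := update_mem_orthant hy q (hy' q)
  have hz' : Function.update y' q (y q) ∈ orthant V := update_mem_orthant hy' q (hy q)
  have : ∀ i, IsProbabilityMeasure (P.map fun ω => Phi T C r (X ω) i) := fun i =>
    Measure.isProbabilityMeasure_map (((measurable_pi_apply i).comp
      (continuous_Phi r).measurable).comp_aemeasurable hX.aemeasurable)
  have hexchange := congrArg Real.log (mul_eq_mul_exchange_of_withDensity_eq_pi
    (fun _ => pushDensity_pos hC hf_pos) (continuousOn_pushDensity hC hf) _
    (withDensity_pushDensity_eq_pi hC hX hindep) q hy hy')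
  rw [Real.log_mul (hpos hz) (hpos hz'), Real.log_mul (hpos hy) (hpos hy'),
    log_pushDensity hC hf_pos hz, log_pushDensity hC hf_pos hz', log_pushDensity hC hf_pos hy,
    log_pushDensity hC hf_pos hy'] at hexchange
  linarith [sum_update_add_sum_update Real.log y y' q]

end Independence

section TreeKummerLaw

variable {V : Type*} [Fintype V] {T : SimpleGraph V} {C : Matrix V V ℝ}

/-- The unnormalized density of the tree-Kummer law `TK(a, c • C)`. -/
def treeKummerDensity (T : SimpleGraph V) (C : Matrix V V ℝ) (hC : C.IsSymm) (a : V → ℝ) (c : ℝ)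
    (x : V → ℝ) : ℝ :=
  (∏ i, x i ^ (a i - 1)) * Real.exp (-(c * energy T C hC x))

/-- The measure on the open orthant with density `treeKummerDensity`; it is the tree-Kummer law
`TK(a, c • C)` up to normalization, but need not be finite for arbitrary `a` and `c`. -/
def treeKummerWeight (T : SimpleGraph V) (C : Matrix V V ℝ) (hC : C.IsSymm) (a : V → ℝ) (c : ℝ) :
    Measure (V → ℝ) :=
  (volume.restrict (orthant V)).withDensity
    fun x => ENNReal.ofReal (treeKummerDensity T C hC a c x)

theorem treeKummerMeasure_smul (hT : T.IsTree) (hC : IsParam T C) (a : V → ℝ) {c : ℝ}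
    (hc : 0 < c) :
    treeKummerMeasure T a (c • C) (hC.symm.smul c) =
      normalize (treeKummerWeight T C hC.symm a c) := by
  simp only [treeKummerMeasure, treeKummerWeight, treeKummerDensity, energy_smul hT hC hc]

theorem eq_exp_mul_treeKummerDensity {hC : C.IsSymm} {a x : V → ℝ} {b c u : ℝ} (hu : 0 < u)
    (hx : x ∈ orthant V)
    (h : Real.log u + ∑ i, Real.log (x i) =
      b + (∑ i, a i * Real.log (x i) - c * energy T C hC x)) :
    u = Real.exp b * treeKummerDensity T C hC a c x := by
  have hprod : ∏ i, x i ^ (a i - 1) =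
      Real.exp (∑ i, a i * Real.log (x i) - ∑ i, Real.log (x i)) := by
    rw [← Finset.sum_sub_distrib, Real.exp_sum]
    refine Finset.prod_congr rfl fun i _ => ?_
    rw [Real.rpow_def_of_pos (hx i), mul_sub_one, mul_comm]
  rw [treeKummerDensity, hprod, ← Real.exp_add, ← Real.exp_add, ← Real.exp_log hu]
  exact congrArg Real.exp (by linarith)

theorem exists_hasLaw_smul_treeKummerWeight [DecidableRel T.Adj] (hT : T.IsTree)
    (hcard : 2 ≤ Fintype.card V) (hC : IsParam T C) {Ω : Type*} [MeasurableSpace Ω]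
    {P : Measure Ω} [IsProbabilityMeasure P] {X : Ω → V → ℝ} {f : (V → ℝ) → ℝ}
    (hf_pos : ∀ x ∈ orthant V, 0 < f x) (hf : ContDiffOn ℝ 1 f (orthant V))
    (hX : HasLaw X ((volume.restrict (orthant V)).withDensity
      fun x => ENNReal.ofReal (f x)) P)
    (hindep : ∀ r, T.degree r = 1 → iIndepFun (fun i ω => Phi T C r (X ω) i) P) :
    ∃ (a : V → ℝ) (c : ℝ) (κ : ENNReal), HasLaw X (κ • treeKummerWeight T C hC.symm a c) P := by
  classical
  have hL : ContDiffOn ℝ 1 (fun x => Real.log (f x) + ∑ i, Real.log (x i)) (orthant V) :=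
    (hf.log fun x hx => (hf_pos x hx).ne').add (ContDiffOn.sum fun i _ =>
      (contDiff_apply ℝ ℝ i).contDiffOn.log fun x hx => (hx i).ne')
  obtain ⟨a, c, b, hlog⟩ := exists_eq_sum_mul_log_sub_energy hT hcard hC hL fun r hr =>
    isSeparable_of_iIndepFun hC hf_pos hf.continuousOn hX (hindep r hr)
  refine ⟨a, c, ENNReal.ofReal (Real.exp b), ?_⟩
  rw [treeKummerWeight, ← withDensity_smul' _ _ ENNReal.ofReal_ne_top]
  refine ⟨hX.aemeasurable, hX.map_eq.trans (withDensity_congr_ae ?_)⟩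
  filter_upwards [ae_restrict_mem measurableSet_orthant] with x hx
  rw [eq_exp_mul_treeKummerDensity (hf_pos x hx) hx (hlog x hx), Pi.smul_apply, smul_eq_mul,
    ENNReal.ofReal_mul (Real.exp_pos b).le]

end TreeKummerLaw

section Components

variable {V : Type*} [Fintype V] {T : SimpleGraph V} {C : Matrix V V ℝ} {a : V → ℝ} {c : ℝ}
  {r i j : V}

open Classical in
/-- The unnormalized density of the coordinate `i` of `Phi T C r X` when `X` has the density
`treeKummerDensity`. The product over the parents of `i` is empty if `i` is the root and has a
single factor otherwise. -/
def componentDensity (T : SimpleGraph V) (C : Matrix V V ℝ) (a : V → ℝ) (c : ℝ) (r i : V)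
    (t : ℝ) : ℝ :=
  t ^ (a i - 1) * Real.exp (-(c * C i i * t)) /
    ∏ p with IsParent T r p i, (1 + C p i / C p p * t) ^ a p

theorem componentDensity_root :
    componentDensity T C a c r r = fun t => t ^ (a r - 1) * Real.exp (-(c * C r r * t)) := by
  classical
  funext t
  rw [componentDensity, Finset.filter_false_of_mem fun p _ hp => hp.ne_root rfl,
    Finset.prod_empty, div_one]

theorem componentDensity_of_isParent (hT : T.IsTree) (h : IsParent T r j i) :
    componentDensity T C a c r i = fun t =>
      t ^ (a i - 1) * Real.exp (-(c * C i i * t)) / (1 + C j i / C j j * t) ^ a j := by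
  classical
  have hparents : ({p | IsParent T r p i} : Finset V) = {j} := by
    ext p
    rw [Finset.mem_filter_univ, Finset.mem_singleton]
    exact ⟨fun hp => hp.eq_left hT h, fun hp => hp ▸ h⟩
  funext t
  rw [componentDensity, ← Finset.prod_singleton (fun p => (1 + C p i / C p p * t) ^ a p) j,
    ← hparents]

theorem measurable_componentDensity : Measurable (componentDensity T C a c r i) := by
  unfold componentDensity
  fun_prop

theorem componentDensity_nonneg (hC : IsParam T C) {t : ℝ} (ht : 0 < t) :
    0 ≤ componentDensity T C a c r i t := by
  classical
  refine div_nonneg (by positivity) (Finset.prod_nonneg fun p hp => ?_)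
  have := hC.ratio_pos (Finset.mem_filter.1 hp).2.1
  positivity

theorem Psi_rpow_sub_one_mul_div (hC : IsParam T C) {y : V → ℝ} (hy : y ∈ orthant V) :
    Psi T C r y i ^ (a i - 1) * (Psi T C r y i / y i) =
      y i ^ (a i - 1) / ∏ j ∈ children T r i, (1 + C i j / C i i * y j) ^ a i := by
  have hfactor (j) (hj : j ∈ children T r i) : 0 ≤ 1 + C i j / C i i * y j :=
    add_nonneg zero_le_one (mul_pos (hC.ratio_pos (mem_children.1 hj).1) (hy j)).le
  have hpos := prod_children_pos hC (r := r) (i := i) fun j _ => hy j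
  rw [Real.finsetProd_rpow _ _ hfactor, Psi, Real.div_rpow (hy i).le hpos.le,
    Real.rpow_sub_one hpos.ne', div_right_comm, div_self (hy i).ne', div_div_eq_mul_div,
    div_mul_div_comm, mul_one, mul_div_mul_right _ _ hpos.ne']

theorem exp_neg_energy_Psi (hT : T.IsTree) (hC : IsParam T C) {y : V → ℝ} (hy : y ∈ orthant V) :
    Real.exp (-(c * energy T C hC.symm (Psi T C r y))) = ∏ i, Real.exp (-(c * C i i * y i)) := by
  rw [energy_eq_sum_Phi hT hC r, Phi_Psi hC r hy, ← Real.exp_sum, Finset.sum_neg_distrib,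
    Finset.mul_sum]
  simp only [mul_assoc]

theorem pushDensity_treeKummerDensity (hT : T.IsTree) (hC : IsParam T C) {y : V → ℝ}
    (hy : y ∈ orthant V) :
    pushDensity T C r (treeKummerDensity T C hC.symm a c) y =
      ∏ i, componentDensity T C a c r i (y i) := by
  classical
  have hswap : ∏ i, ∏ j ∈ children T r i, (1 + C i j / C i i * y j) ^ a i =
      ∏ j, ∏ p with IsParent T r p j, (1 + C p j / C p p * y j) ^ a p :=
    Finset.prod_comm' fun i j => by simp [mem_children]
  calc pushDensity T C r (treeKummerDensity T C hC.symm a c) y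
      = (∏ i, Psi T C r y i ^ (a i - 1) * (Psi T C r y i / y i)) *
          Real.exp (-(c * energy T C hC.symm (Psi T C r y))) := by
        rw [pushDensity, treeKummerDensity, Finset.prod_mul_distrib, mul_right_comm]
    _ = (∏ i, y i ^ (a i - 1)) / (∏ j, ∏ p with IsParent T r p j,
          (1 + C p j / C p p * y j) ^ a p) * ∏ i, Real.exp (-(c * C i i * y i)) := by
        rw [Finset.prod_congr rfl fun i _ => Psi_rpow_sub_one_mul_div hC hy,
          Finset.prod_div_distrib, hswap, exp_neg_energy_Psi hT hC hy]
    _ = ∏ i, componentDensity T C a c r i (y i) := by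
        simp only [componentDensity, Finset.prod_div_distrib, Finset.prod_mul_distrib]
        ring

theorem pi_halfLine_componentDensity (hC : IsParam T C) :
    Measure.pi (fun i => halfLine (componentDensity T C a c r i)) =
      (volume.restrict (orthant V)).withDensity fun y =>
        ENNReal.ofReal (∏ i, componentDensity T C a c r i (y i)) := by
  have hsigma (i) : SigmaFinite ((volume.restrict (Ioi (0 : ℝ))).withDensity
      fun x => ENNReal.ofReal (componentDensity T C a c r i x)) := sigmaFinite_halfLine _
  simp only [halfLine]
  rw [pi_withDensity fun _ => measurable_componentDensity.ennreal_ofReal, ← restrict_orthant_eq_pi]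
  refine withDensity_congr_ae ?_
  filter_upwards [ae_restrict_mem measurableSet_orthant] with y hy
  rw [ENNReal.ofReal_prod_of_nonneg fun i _ => componentDensity_nonneg hC (hy i)]

theorem map_Phi_treeKummerWeight (hT : T.IsTree) (hC : IsParam T C) :
    (treeKummerWeight T C hC.symm a c).map (Phi T C r) =
      Measure.pi fun i => halfLine (componentDensity T C a c r i) := by
  rw [treeKummerWeight, map_Phi_withDensity hC, pi_halfLine_componentDensity hC]
  refine withDensity_congr_ae ?_
  filter_upwards [ae_restrict_mem measurableSet_orthant] with y hy
  rw [pushDensity_treeKummerDensity hT hC hy]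

variable {Ω : Type*} [MeasurableSpace Ω] {P : Measure Ω} {X : Ω → V → ℝ} {κ : ENNReal}

theorem exists_hasLaw_smul_halfLine_componentDensity (hT : T.IsTree) (hC : IsParam T C)
    (hX : HasLaw X (κ • treeKummerWeight T C hC.symm a c) P) (r i : V) :
    ∃ κ' : ENNReal, HasLaw (fun ω => Phi T C r (X ω) i)
      (κ' • halfLine (componentDensity T C a c r i)) P := by
  classical
  have hPhi : Measurable (Phi T C r) := (continuous_Phi r).measurable
  refine ⟨κ * ∏ j ∈ Finset.univ.erase i, halfLine (componentDensity T C a c r j) univ,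
    HasLaw.comp (Y := Function.eval i ∘ Phi T C r)
      ⟨((measurable_pi_apply i).comp hPhi).aemeasurable, ?_⟩ hX⟩
  rw [Measure.map_smul, ← Measure.map_map (measurable_pi_apply i) hPhi,
    map_Phi_treeKummerWeight hT hC, Measure.pi_map_eval, smul_smul]

theorem exists_hasLaw_Phi_root (hT : T.IsTree) (hC : IsParam T C)
    (hX : HasLaw X (κ • treeKummerWeight T C hC.symm a c) P) (r : V) :
    ∃ κ' : ENNReal, HasLaw (fun ω => Phi T C r (X ω) r)
      (κ' • halfLine fun t => t ^ (a r - 1) * Real.exp (-(c * C r r * t))) P :=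
  componentDensity_root (T := T) (C := C) ▸
    exists_hasLaw_smul_halfLine_componentDensity hT hC hX r r

variable [IsProbabilityMeasure P]

theorem shape_pos_of_hasLaw (hT : T.IsTree) (hC : IsParam T C)
    (hX : HasLaw X (κ • treeKummerWeight T C hC.symm a c) P) (i : V) : 0 < a i :=
  let ⟨_, h⟩ := exists_hasLaw_Phi_root hT hC hX i
  (pos_and_pos_of_hasLaw_smul_halfLine h).1

theorem rate_pos_of_hasLaw (hT : T.IsTree) (hC : IsParam T C)
    (hX : HasLaw X (κ • treeKummerWeight T C hC.symm a c) P) : 0 < c := by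
  obtain ⟨r⟩ := hT.connected.nonempty
  obtain ⟨_, h⟩ := exists_hasLaw_Phi_root hT hC hX r
  exact pos_of_mul_pos_left (pos_and_pos_of_hasLaw_smul_halfLine h).2 (hC.diag_pos r).le

theorem hasLaw_Phi_root (hT : T.IsTree) (hC : IsParam T C)
    (hX : HasLaw X (κ • treeKummerWeight T C hC.symm a c) P) (r : V) :
    HasLaw (fun ω => Phi T C r (X ω) r) (gammaMeasure (a r) (c * C r r)) P :=
  let ⟨_, h⟩ := exists_hasLaw_Phi_root hT hC hX r
  hasLaw_gammaMeasure_of_smul_halfLine h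

theorem hasLaw_Phi_of_isParent (hT : T.IsTree) (hC : IsParam T C)
    (hX : HasLaw X (κ • treeKummerWeight T C hC.symm a c) P) (h : IsParent T r j i) :
    HasLaw (fun ω => C j i / C j j * Phi T C r (X ω) i)
      (kummerMeasure (a i) (a j - a i) (c * (C j j * C i i / C j i))) P := by
  obtain ⟨κ', hcomponent⟩ := exists_hasLaw_smul_halfLine_componentDensity hT hC hX r i
  rw [componentDensity_of_isParent hT h] at hcomponent
  have hrate : c * (C j j * C i i / C j i) = c * C i i / (C j i / C j j) := by
    have := (hC.diag_pos j).ne'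
    field_simp
  rw [hrate]
  exact hasLaw_kummerMeasure_of_smul_halfLine (hC.ratio_pos h.1) hcomponent

theorem hasLaw_treeKummerMeasure (hT : T.IsTree) (hC : IsParam T C)
    (hX : HasLaw X (κ • treeKummerWeight T C hC.symm a c) P) :
    HasLaw X (treeKummerMeasure T a (c • C) (hC.symm.smul c)) P := by
  rw [treeKummerMeasure_smul hT hC a (rate_pos_of_hasLaw hT hC hX)]
  exact hasLaw_normalize_of_smul hX

end Components

end TreeKummer

end

theorem theorem4p2 {V : Type*} [Fintype V] (T : SimpleGraph V) [DecidableRel T.Adj]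
    (hT : T.IsTree) (hcard : 2 ≤ Fintype.card V)
    (C : Matrix V V ℝ) (hC : TreeKummer.IsParam T C)
    {Ω : Type*} [MeasurableSpace Ω] (P : Measure Ω) [IsProbabilityMeasure P]
    (X : Ω → V → ℝ) (f : (V → ℝ) → ℝ)
    (hf_pos : ∀ x ∈ TreeKummer.orthant V, 0 < f x)
    (hf_smooth : ContDiffOn ℝ 1 f (TreeKummer.orthant V))
    (hX : HasLaw X ((volume.restrict (TreeKummer.orthant V)).withDensity
      fun x => ENNReal.ofReal (f x)) P)
    (hindep : ∀ r : V, T.degree r = 1 →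
      iIndepFun (fun (i : V) (ω : Ω) => TreeKummer.Phi T C r (X ω) i) P) :
    ∃ (a : V → ℝ) (c : ℝ), (∀ i, 0 < a i) ∧ 0 < c ∧
      (∀ r : V,
        HasLaw (fun ω => TreeKummer.Phi T C r (X ω) r) (gammaMeasure (a r) (c * C r r)) P ∧
        ∀ i j : V, TreeKummer.IsParent T r j i →
          HasLaw (fun ω => C j i / C j j * TreeKummer.Phi T C r (X ω) i)
            (TreeKummer.kummerMeasure (a i) (a j - a i) (c * (C j j * C i i / C j i))) P) ∧
      HasLaw X (TreeKummer.treeKummerMeasure T a (c • C) (hC.symm.smul c)) P := by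
  obtain ⟨a, c, κ, hlaw⟩ :=
    TreeKummer.exists_hasLaw_smul_treeKummerWeight hT hcard hC hf_pos hf_smooth hX hindep
  exact ⟨a, c, TreeKummer.shape_pos_of_hasLaw hT hC hlaw, TreeKummer.rate_pos_of_hasLaw hT hC hlaw,
    fun r => ⟨TreeKummer.hasLaw_Phi_root hT hC hlaw r,
      fun _ _ hij => TreeKummer.hasLaw_Phi_of_isParent hT hC hlaw hij⟩,
    TreeKummer.hasLaw_treeKummerMeasure hT hC hlaw⟩
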